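/- Let $(V,\omega,\tau)$ consist of a finite dimensional complex symplectic vector space $(V,\omega)$ and an antilinear involution $\tau$ of $V$ such that $\omega$ restricts to a real symplectic form on the fixed point set $V^\tau$. Put $\gamma(u,v)=\sqrt{-1}\,\omega(u,\tau v)$. Let $V^\tau=L_0\oplus L_0'$ be a splitting into Lagrangean subspaces, $V=L\oplus L'$ the induced $\tau$-invariant splitting (so $L_0=L^\tau$, $L_0'=(L')^\tau$), and $p:V\to L$ the projection along $L'$. Let $M\subset V$ be a complex submanifold such that, for all $m\in M$, $T_mM\subset V$ is a Lagrangean subspace on which $\gamma$ is nondegenerate, and such that $p$ induces an isomorphism of $M$ onto its image (general position). Let $g_m=\gamma|T_mM$, let $g_m^{-1}$ be the inverse Hermitian form on $T^*_mM$, and let $\rho$ be the real structure on $T^*_mM$ dual to the real structure of $T_mM$ whose fixed point set is mapped onto $L_0$ by the isomorphism $dp:T_mM\to L$. Let $N=(T^*M,G)$, where $T^*M$ is the holomorphic cotangent bundle with projection $\pi:T^*M\to M$ and $G=\left(\partial^2K/\partial z^I\partial\bar z^J\right)$ is the metric with potential $$K(\sigma)=\gamma(\pi(\sigma),\pi(\sigma))+g^{-1}_{\pi(\sigma)}(\sigma+\rho(\sigma),\sigma+\rho(\sigma)),$$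 and let $\Omega=\sum_i dz^i\wedge dw_i$ be the standard complex symplectic structure of $T^*M$. For $m\in M$ let $\psi_m:V^\tau\to T^*_mM$, $\psi_m(v)=\omega(v,\cdot)|T_mM$. Let $\mathrm{Aut}_{sd}(M)$ be the group of complex linear automorphisms $\varphi$ of $(V,\omega,\tau)$ with $\varphi M=M$, $\varphi L=L$, $\varphi L'=L'$, and let $V^\tau\rtimes \mathrm{Aut}_{sd}(M)$ be the affine group formed with its linear action on $V^\tau$. Then there is an action of the group $V^\tau\rtimes \mathrm{Aut}_{sd}(M)$ on $N$ by holomorphic isometries (holomorphic maps preserving $G$) preserving $\Omega$, such that: 1. Each $\varphi\in \mathrm{Aut}_{sd}(M)$ acts by the point transformation $T^*_mM\ni\sigma\mapsto \sigma\circ (df_m)^{-1}\in T^*_{f(m)}M$, where the biholomorphic map $f:M\to M$ is the restriction of $\varphi$ to $M$. 2. Each $v\in V^\tau$ acts by $T^*_mM\ni\sigma\mapsto\sigma+\sqrt{-1}\,\psi_m(v)\in T_m^*M$. This action of $V^\tau$ is fibre preserving and simply transitive on each fibre $T^*_mM$, and it changes the potential $K$ only by a pluriharmonic function. -/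

import Mathlib

open Bundle Manifold
open scoped ContDiff Topology

noncomputable section

namespace Cmap

/-! ### Fundamental algebraic data -/

/-- Fundamental algebraic data `(V, ω, τ)`: a complex symplectic vector space with a compatible
real structure, that is, an antilinear involution such that `ω` restricts to a real symplectic
form on the fixed point set of `τ`. -/
structure FundamentalData (V : Type*) [AddCommGroup V] [Module ℂ V] where
  omega : V →ₗ[ℂ] V →ₗ[ℂ] ℂ
  omega_alt : ∀ u, omega u u = 0
  omega_nondeg : ∀ u, (∀ v, omega u v = 0) → u = 0
  tau : V →ₛₗ[starRingEnd ℂ] V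
  tau_tau : ∀ v, tau (tau v) = v
  omega_real : ∀ u v, tau u = u → tau v = v → (omega u v).im = 0
  omega_real_nondeg : ∀ u, tau u = u → (∀ v, tau v = v → omega u v = 0) → u = 0

section Linear

variable {V : Type*} [AddCommGroup V] [Module ℂ V] (D : FundamentalData V)

/-- The Hermitian form `γ(u,v) = √-1 ω(u, τ v)`. -/
def gammaForm (u v : V) : ℂ := Complex.I * D.omega u (D.tau v)

/-- The real vector space `V^τ` of fixed points of `τ`. -/
def realPoints : Submodule ℝ V where
  carrier := {v | D.tau v = v}
  add_mem' {a b} ha hb := by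
    rw [Set.mem_ofPred_eq] at *
    rw [map_add, ha, hb]
  zero_mem' := map_zero D.tau
  smul_mem' c v hv := by
    rw [Set.mem_ofPred_eq] at *
    rw [← Complex.coe_smul, map_smulₛₗ, hv, Complex.conj_ofReal]

/-- Lagrangean subspaces of the complex symplectic vector space `(V, ω)`: those which are equal
to their `ω`-orthogonal complement (equivalently, maximal isotropic subspaces). -/
def IsLagrangean (W : Submodule ℂ V) : Prop :=
  ∀ v : V, v ∈ W ↔ ∀ w ∈ W, D.omega v w = 0

/-- Lagrangean subspaces of the real symplectic vector space `(V^τ, ω|V^τ)`. -/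
def IsRealLagrangean (W : Submodule ℝ V) : Prop :=
  W ≤ realPoints D ∧ ∀ v ∈ realPoints D, v ∈ W ↔ ∀ w ∈ W, D.omega v w = 0

/-- A Lagrangean splitting `V^τ = L₀ ⊕ L₀'` together with the induced splitting `V = L ⊕ L'`,
where `L = τ L`, `L' = τ L'`, `L₀ = L^τ` and `L₀' = (L')^τ`. -/
structure LagrangeanSplitting where
  L₀ : Submodule ℝ V
  L₀' : Submodule ℝ V
  lagrangean : IsRealLagrangean D L₀
  lagrangean' : IsRealLagrangean D L₀'
  disjoint_real : L₀ ⊓ L₀' = ⊥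
  sup_real : L₀ ⊔ L₀' = realPoints D
  L : Submodule ℂ V
  L' : Submodule ℂ V
  isCompl : IsCompl L L'
  tau_L : ∀ v, v ∈ L ↔ D.tau v ∈ L
  tau_L' : ∀ v, v ∈ L' ↔ D.tau v ∈ L'
  mem_L₀ : ∀ v, v ∈ L₀ ↔ v ∈ L ∧ D.tau v = v
  mem_L₀' : ∀ v, v ∈ L₀' ↔ v ∈ L' ∧ D.tau v = v

variable {D}

/-- The projection `p : V → L` along `L'`. -/
def LagrangeanSplitting.proj (S : LagrangeanSplitting D) : V →ₗ[ℂ] S.L :=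
  S.L.projectionOnto S.L' S.isCompl

/-- The real structure `τ|L` of `L`; its fixed point set is `L₀`. -/
def LagrangeanSplitting.tauL (S : LagrangeanSplitting D) : S.L →ₛₗ[starRingEnd ℂ] S.L where
  toFun v := ⟨D.tau v, (S.tau_L v).1 v.2⟩
  map_add' a b := Subtype.ext (map_add D.tau (a : V) b)
  map_smul' c a := Subtype.ext (D.tau.map_smulₛₗ c (a : V))

end Linear

/-! ### Complex manifolds: complex Hessian, point transformations -/

section Manifolds

/-- The complex Hessian `∑ ∂²f/∂z^I∂\bar z^J (z) u^I \bar v^J` of a real function `f` on a complex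
vector space, expressed through the second real derivative of `f`. -/
def complexHessian {F : Type*} [NormedAddCommGroup F] [NormedSpace ℂ F]
    (f : F → ℝ) (z u v : F) : ℂ :=
  let B : F → F → ℝ := fun a b => fderiv ℝ (fderiv ℝ f) z a b
  (1 / 4 : ℂ) * ((B u v + B (Complex.I • u) (Complex.I • v) : ℝ) +
    Complex.I * (B u (Complex.I • v) - B (Complex.I • u) v : ℝ))

variable {F H X : Type*} [NormedAddCommGroup F] [NormedSpace ℂ F]
  [TopologicalSpace H] (I : ModelWithCorners ℂ F H) [TopologicalSpace X] [ChartedSpace H X]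

/-- The field of sesquilinear forms `∂²f/∂z^I∂\bar z^J` on a complex manifold defined by a real
function `f`, computed at `x` in the holomorphic coordinates used by `TangentSpace I x`. -/
def leviForm (f : X → ℝ) (x : X) (u v : TangentSpace I x) : ℂ :=
  complexHessian (F := F) (f ∘ (extChartAt I x).symm) (extChartAt I x x) u v

/-- A real function of class `C²` on a complex manifold is pluriharmonic if its complex Hessian
vanishes. -/
def IsPluriharmonic (f : X → ℝ) : Prop :=
  ∀ x : X, ContDiffAt ℝ 2 (f ∘ (extChartAt I x).symm) (extChartAt I x x) ∧
    ∀ u v : TangentSpace I x, leviForm I f x u v = 0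

end Manifolds

section Cotangent

variable (E : Type*) [NormedAddCommGroup E] [NormedSpace ℂ E]
  (M : Type*) [TopologicalSpace M] [ChartedSpace E M] [IsManifold 𝓘(ℂ, E) ω M]

/-- The total space of the holomorphic cotangent bundle `T^*M`, the bundle of continuous
`ℂ`-linear maps from the tangent bundle to the trivial bundle. -/
abbrev Cotangent : Type _ :=
  TotalSpace (E →L[ℂ] ℂ) (fun m : M => TangentSpace 𝓘(ℂ, E) m →L[ℂ] Trivial M ℂ m)

/-- The model with corners of `T^*M` as a complex manifold. -/
abbrev cotangentModel : ModelWithCorners ℂ (E × (E →L[ℂ] ℂ)) (ModelProd E (E →L[ℂ] ℂ)) :=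
  𝓘(ℂ, E).prod 𝓘(ℂ, E →L[ℂ] ℂ)

variable {E M}

/-- The standard complex symplectic structure `Ω = ∑ dz^i ∧ dw_i` of `T^*M`. The preferred chart of
`T^*M` at `x` consists of the cotangent coordinates `(z, w)` induced by the preferred chart `z` of
`M` at `π(x)`, and it identifies the tangent space at `x` with `E × E^*`, a tangent vector `u`
having the components `u.1 = dz(u)` and `u.2 = dw(u)`. -/
def Omega (x : Cotangent E M) (u v : TangentSpace (cotangentModel E) x) : ℂ :=
  let u' : E × (E →L[ℂ] ℂ) := u
  let v' : E × (E →L[ℂ] ℂ) := v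
  v'.2 u'.1 - u'.2 v'.1

/-- The point transformation of `T^*M` (cotangent lift) defined by a biholomorphic map `f : M → M`:
`T^*_m M ∋ σ ↦ σ ∘ (df_m)⁻¹ ∈ T^*_{f(m)} M`. -/
def pointTransformation (f : Diffeomorph 𝓘(ℂ, E) 𝓘(ℂ, E) M M ω) (x : Cotangent E M) :
    Cotangent E M :=
  ⟨f x.1, x.2 ∘L (mfderiv 𝓘(ℂ, E) 𝓘(ℂ, E) f x.1).inverse⟩

end Cotangent

/-! ### Lagrangean pseudo Kähler submanifolds and the generalized Calabi Ansatz -/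

section Submanifold

variable {V : Type*} [NormedAddCommGroup V] [NormedSpace ℂ V] [FiniteDimensional ℂ V]
  (D : FundamentalData V) (S : LagrangeanSplitting D)
  {E : Type*} [NormedAddCommGroup E] [NormedSpace ℂ E] [FiniteDimensional ℂ E]
  {M : Type*} [TopologicalSpace M] [ChartedSpace E M] [IsManifold 𝓘(ℂ, E) ω M]
  (ι : M → V)

instance instT2SpaceTangentSpace (m : M) : T2Space (TangentSpace 𝓘(ℂ, E) m) :=
  inferInstanceAs (T2Space E)

instance instFiniteDimensionalTangentSpace (m : M) :
    FiniteDimensional ℂ (TangentSpace 𝓘(ℂ, E) m) :=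
  inferInstanceAs (FiniteDimensional ℂ E)

/-- The differential at `m` of the inclusion `ι : M → V`; its range is `T_m M ⊂ V`. -/
def dincl (m : M) : TangentSpace 𝓘(ℂ, E) m →L[ℂ] V := mfderiv 𝓘(ℂ, E) 𝓘(ℂ, V) ι m

/-- The complex submanifold `ι : M ↪ V` is a Lagrangean pseudo Kähler submanifold of `(V, ω, γ)` in
general position with respect to the splitting `V = L ⊕ L'`. -/
structure IsLagrangeanPseudoKahler : Prop where
  /-- `M` is a complex submanifold of `V`. -/
  embedding : IsSmoothEmbedding 𝓘(ℂ, E) 𝓘(ℂ, V) ω ι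
  /-- All tangent spaces `T_m M` are Lagrangean. -/
  lagrangean : ∀ m, IsLagrangean D (dincl (E := E) ι m).range
  /-- `γ` is nondegenerate on all tangent spaces `T_m M`. -/
  nondegenerate : ∀ m, ∀ u ∈ (dincl (E := E) ι m).range,
    (∀ v ∈ (dincl (E := E) ι m).range, gammaForm D u v = 0) → u = 0
  /-- The projection `p : V → L` induces an isomorphism of `M` onto its image. -/
  generalPosition : IsSmoothEmbedding 𝓘(ℂ, E) 𝓘(ℂ, S.L) ω (fun m : M => S.proj (ι m))

/-- The (pseudo) Kähler metric `g_m = γ|T_m M`. -/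
def metric (m : M) (u v : TangentSpace 𝓘(ℂ, E) m) : ℂ :=
  gammaForm D (dincl ι m u) (dincl ι m v)

/-- The vector `β^♯` dual to the covector `β`, characterized by `g_m(u, β^♯) = β(u)` for all `u`. -/
def sharp (m : M) (β : TangentSpace 𝓘(ℂ, E) m →L[ℂ] ℂ) : TangentSpace 𝓘(ℂ, E) m :=
  Classical.epsilon fun s => ∀ u, metric D ι m u s = β u

/-- The Hermitian form `g_m⁻¹` on `T_m^* M` inverse to `g_m`: `g_m⁻¹(α, β) = g_m(β^♯, α^♯)`, which
is `α(β^♯)`. -/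
def inverseMetric (m : M) (α β : TangentSpace 𝓘(ℂ, E) m →L[ℂ] ℂ) : ℂ :=
  α (sharp D ι m β)

variable {D}

/-- The isomorphism `dp|T_m M : T_m M → L`. -/
def dproj (m : M) : TangentSpace 𝓘(ℂ, E) m →ₗ[ℂ] S.L :=
  S.proj ∘ₗ (dincl ι m).toLinearMap

/-- The canonical real structure `ρ'` on `T_m M`, i.e. the antilinear involution of `T_m M` which
corresponds under the isomorphism `dp : T_m M → L` to the real structure of `L` with fixed point
set `L₀`. -/
def rhoPrime (m : M) :
    TangentSpace 𝓘(ℂ, E) m →ₛₗ[starRingEnd ℂ] TangentSpace 𝓘(ℂ, E) m :=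
  (LinearMap.toContinuousLinearMap (dproj S ι m)).inverse.toLinearMap.comp
    (S.tauL.comp (dproj S ι m))

/-- The real structure `ρ` on `T_m^* M` dual to `ρ'`. -/
def rho (m : M) (σ : TangentSpace 𝓘(ℂ, E) m →L[ℂ] ℂ) : TangentSpace 𝓘(ℂ, E) m →L[ℂ] ℂ :=
  LinearMap.toContinuousLinearMap
    { toFun := fun v => starRingEnd ℂ (σ (rhoPrime S ι m v))
      map_add' := fun u v => by simp only [map_add]
      map_smul' := fun c v => by
        simp only [LinearMap.map_smulₛₗ, map_smul, smul_eq_mul, map_mul, Complex.conj_conj,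
          RingHom.id_apply] }

/-- The potential `K(σ) = K^M(π σ) + g⁻¹(σ + ρ σ, σ + ρ σ)` on `T^*M`, where `K^M(u) = γ(u,u)`. Both
summands are real. -/
def potential (x : Cotangent E M) : ℝ :=
  (gammaForm D (ι x.1) (ι x.1) +
    inverseMetric D ι x.1 (x.2 + rho S ι x.1 x.2) (x.2 + rho S ι x.1 x.2)).re

/-- The (pseudo) hyper Kähler metric `G = ∑ ∂²K/∂z^I∂\bar z^J dz^I d\bar z^J` on `T^*M`. -/
def metricG (x : Cotangent E M) (u v : TangentSpace (cotangentModel E) x) : ℂ :=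
  leviForm (cotangentModel E) (potential S ι) x u v

/-- The linear map `ψ_m : V → V / T_m M ≅ T_m^* M`, `v ↦ ω(v, ·)|T_m M`. -/
def psi (D : FundamentalData V) (m : M) (v : V) : TangentSpace 𝓘(ℂ, E) m →L[ℂ] ℂ :=
  LinearMap.toContinuousLinearMap (D.omega v) ∘L dincl ι m

/-- Automorphisms of the pseudo hyper Kähler structure of `N = (T^*M, G)`: holomorphic isometries
preserving `Ω`. -/
structure IsHyperKahlerAutomorphism (Φ : Equiv.Perm (Cotangent E M)) : Prop where
  holomorphic : ContMDiff (cotangentModel E) (cotangentModel E) ω Φ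
  holomorphic_symm : ContMDiff (cotangentModel E) (cotangentModel E) ω Φ.symm
  isometry : ∀ (x : Cotangent E M) (u v : TangentSpace (cotangentModel E) x),
    metricG S ι (Φ x) (mfderiv (cotangentModel E) (cotangentModel E) Φ x u)
      (mfderiv (cotangentModel E) (cotangentModel E) Φ x v) = metricG S ι x u v
  symplectic : ∀ (x : Cotangent E M) (u v : TangentSpace (cotangentModel E) x),
    Omega (Φ x) (mfderiv (cotangentModel E) (cotangentModel E) Φ x u)
      (mfderiv (cotangentModel E) (cotangentModel E) Φ x v) = Omega x u v

end Submanifold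

/-! ### The affine group -/

section Group

variable {V : Type*} [AddCommGroup V] [Module ℂ V] {D : FundamentalData V}

/-- The subgroup `Aut_sd(M)` of the duality group consisting of those linear automorphisms of
`(V, ω, τ)` which preserve `M`, `L` and `L'`. -/
def autSd (S : LagrangeanSplitting D) {M : Type*} (ι : M → V) : Subgroup (V ≃ₗ[ℂ] V) where
  carrier := {φ | (∀ u v, D.omega (φ u) (φ v) = D.omega u v) ∧ (∀ v, φ (D.tau v) = D.tau (φ v)) ∧
    (∀ v, v ∈ Set.range ι ↔ φ v ∈ Set.range ι) ∧
    (∀ v, v ∈ S.L ↔ φ v ∈ S.L) ∧ (∀ v, v ∈ S.L' ↔ φ v ∈ S.L')}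
  mul_mem' := by
    rintro a b ⟨a1, a2, a3, a4, a5⟩ ⟨b1, b2, b3, b4, b5⟩
    refine ⟨fun u v => ?_, fun v => ?_, fun v => ?_, fun v => ?_, fun v => ?_⟩
    · rw [LinearEquiv.mul_apply, LinearEquiv.mul_apply, a1, b1]
    · rw [LinearEquiv.mul_apply, LinearEquiv.mul_apply, b2, a2]
    · rw [LinearEquiv.mul_apply, ← a3, ← b3]
    · rw [LinearEquiv.mul_apply, ← a4, ← b4]
    · rw [LinearEquiv.mul_apply, ← a5, ← b5]
  one_mem' := ⟨fun _ _ => rfl, fun _ => rfl, fun _ => Iff.rfl, fun _ => Iff.rfl, fun _ => Iff.rfl⟩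
  inv_mem' := by
    rintro a ⟨a1, a2, a3, a4, a5⟩
    have h : ∀ v, a (a⁻¹ v) = v := fun v => a.apply_symm_apply v
    refine ⟨fun u v => ?_, fun v => ?_, fun v => ?_, fun v => ?_, fun v => ?_⟩
    · rw [← a1, h, h]
    · apply a.injective
      rw [a2, h, h]
    · rw [a3 (a⁻¹ v), h]
    · rw [a4 (a⁻¹ v), h]
    · rw [a5 (a⁻¹ v), h]

theorem autSd_tau {S : LagrangeanSplitting D} {M : Type*} {ι : M → V} (φ : autSd S ι)
    {v : V} (hv : v ∈ realPoints D) : (φ : V ≃ₗ[ℂ] V) v ∈ realPoints D := by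
  have h : D.tau ((φ : V ≃ₗ[ℂ] V) v) = (φ : V ≃ₗ[ℂ] V) (D.tau v) := (φ.2.2.1 v).symm
  have hv' : D.tau v = v := hv
  change D.tau ((φ : V ≃ₗ[ℂ] V) v) = (φ : V ≃ₗ[ℂ] V) v
  rw [h, hv']

/-- The linear action of `Aut_sd(M)` on the vector group `V^τ` (written multiplicatively). -/
def autSdAction (S : LagrangeanSplitting D) {M : Type*} (ι : M → V) :
    autSd S ι →* MulAut (Multiplicative (realPoints D)) where
  toFun φ :=
    { toFun := fun v => .ofAdd ⟨(φ : V ≃ₗ[ℂ] V) v.toAdd, autSd_tau φ v.toAdd.2⟩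
      invFun := fun v => .ofAdd ⟨(φ⁻¹ : autSd S ι).1 v.toAdd, autSd_tau φ⁻¹ v.toAdd.2⟩
      left_inv := fun v => Subtype.ext ((φ : V ≃ₗ[ℂ] V).symm_apply_apply (v.toAdd : V))
      right_inv := fun v => Subtype.ext ((φ : V ≃ₗ[ℂ] V).apply_symm_apply (v.toAdd : V))
      map_mul' := fun u v =>
        Subtype.ext (map_add (φ : V ≃ₗ[ℂ] V) (u.toAdd : V) (v.toAdd : V)) }
  map_one' := rfl
  map_mul' _ _ := rfl

/-- The affine group `V^τ ⋊ Aut_sd(M)`. -/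
abbrev AffineGroup (S : LagrangeanSplitting D) {M : Type*} (ι : M → V) : Type _ :=
  Multiplicative (realPoints D) ⋊[autSdAction S ι] autSd S ι

/-- The element of `V^τ ⋊ Aut_sd(M)` given by a vector `v ∈ V^τ`. -/
def AffineGroup.ofVector (S : LagrangeanSplitting D) {M : Type*} (ι : M → V)
    (v : realPoints D) : AffineGroup S ι := SemidirectProduct.inl (.ofAdd v)

/-- The element of `V^τ ⋊ Aut_sd(M)` given by an automorphism `φ ∈ Aut_sd(M)`. -/
def AffineGroup.ofAut (S : LagrangeanSplitting D) {M : Type*} (ι : M → V)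
    (φ : autSd S ι) : AffineGroup S ι := SemidirectProduct.inr φ

end Group

end Cmap

end

/-! The key is that real vectors parametrize covectors. On a tangent space which is Lagrangean with
`γ` nondegenerate, `v ↦ √-1 ψ_m(v)` is a real-linear bijection from `V^τ` onto `T*_m M`
(`realPsi_bijective`); this is simple transitivity on the fibres. It also makes the potential
computable: if `σ = √-1 ψ_m(v)` and `x` is the tangent vector over `p v ∈ L`, then `σ + ρ σ =
-g_m(·, x)` (`realPsi_add_conj`, from the isotropy of `L'` and of `T_m M`). Hence `K(σ) = γ(m,m) +
g_m(x,x)` (`potential_eq`).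

Translating by `v`, with `y` the tangent vector over `p v`, expands the quadratic term. The
increment of `K` is the real part of `-4 σ(y) - 2 √-1 ψ_m(v)(y)` (`potential_add_sub`). Since `y`
depends holomorphically on `m`, this is the real part of a holomorphic function on `T*M`, so it is
pluriharmonic and the complex Hessian `G` is unchanged. Moreover `√-1 ψ(v)` is the differential of
the holomorphic function `√-1 ω(v, ι)`, and fibre translation by an exact form preserves `Ω`.

An element `φ` of `Aut_sd(M)` preserves `γ` and `L'` and commutes with `τ`, so its point
transformation carries `√-1 ψ_m(v)` to `√-1 ψ_{f(m)}(φ v)` and `x` to `df x`. This yields both `K ∘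
Φ = K` and the commutation relation that assembles the two actions into one of the semidirect
product. Point transformations are always symplectic.

The remaining analytic work is to read these maps in cotangent charts and to show that `K` is smooth
enough for the holomorphic chain rule for complex Hessians. -/

noncomputable section

namespace Cmap

/-! ### Complex Hessians on complex vector spaces. -/

section Analysis

variable {F F' : Type*} [NormedAddCommGroup F] [NormedSpace ℂ F]
  [NormedAddCommGroup F'] [NormedSpace ℂ F']

theorem complexHessian_congr {f g : F → ℝ} {z : F} (h : f =ᶠ[𝓝 z] g) (u v : F) :
    complexHessian f z u v = complexHessian g z u v := by
  simp only [complexHessian, h.fderiv.fderiv_eq]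

theorem complexHessian_add {f g : F → ℝ} {z : F} (hf : ContDiffAt ℝ 2 f z)
    (hg : ContDiffAt ℝ 2 g z) (u v : F) :
    complexHessian (f + g) z u v = complexHessian f z u v + complexHessian g z u v := by
  have key : fderiv ℝ (fderiv ℝ (f + g)) z =
      fderiv ℝ (fderiv ℝ f) z + fderiv ℝ (fderiv ℝ g) z := by
    have h : fderiv ℝ (f + g) =ᶠ[𝓝 z] fderiv ℝ f + fderiv ℝ g := by
      filter_upwards [hf.eventually (by simp), hg.eventually (by simp)] with y hy hy'
      exact fderiv_add (hy.differentiableAt (by simp)) (hy'.differentiableAt (by simp))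
    rw [h.fderiv_eq]
    exact fderiv_add ((hf.fderiv_right (m := 1) le_rfl).differentiableAt (by simp))
      ((hg.fderiv_right (m := 1) le_rfl).differentiableAt (by simp))
  simp only [complexHessian, key, add_apply]
  push_cast
  ring

/-- Near `z` the real derivative is the complex one with scalars restricted. The consequence needed
is that the second real derivative of a holomorphic map is complex bilinear. -/
theorem fderiv_real_fderiv_real {Φ : F → F'} {z : F} (hΦ : ContDiffAt ℂ 2 Φ z) (u v : F) :
    fderiv ℝ (fderiv ℝ Φ) z u v = fderiv ℂ (fderiv ℂ Φ) z u v := by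
  have h : fderiv ℝ Φ =ᶠ[𝓝 z]
      fun y => ContinuousLinearMap.restrictScalarsL ℂ F F' ℝ ℝ (fderiv ℂ Φ y) := by
    filter_upwards [hΦ.eventually (by simp)] with y hy
    exact (hy.differentiableAt (by simp)).fderiv_restrictScalars ℝ
  have h' := ((hΦ.fderiv_right (m := 1) le_rfl).differentiableAt
    (by simp)).hasFDerivAt.restrictScalars ℝ
  have h'' : HasFDerivAt
      (fun y => ContinuousLinearMap.restrictScalarsL ℂ F F' ℝ ℝ (fderiv ℂ Φ y)) _ z :=
    (ContinuousLinearMap.restrictScalarsL ℂ F F' ℝ ℝ).hasFDerivAt.comp z h'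
  rw [h.fderiv_eq, h''.fderiv]
  rfl

/-- The complex Hessian is invariant under holomorphic changes of variables. -/
theorem complexHessian_comp {f : F' → ℝ} {Φ : F → F'} {z : F} (hf : ContDiffAt ℝ 2 f (Φ z))
    (hΦ : ContDiffAt ℂ 2 Φ z) (u v : F) :
    complexHessian (f ∘ Φ) z u v =
      complexHessian f (Φ z) (fderiv ℂ Φ z u) (fderiv ℂ Φ z v) := by
  have key : ∀ a b, fderiv ℝ (fderiv ℝ (f ∘ Φ)) z a b =
      fderiv ℝ (fderiv ℝ f) (Φ z) (fderiv ℂ Φ z a) (fderiv ℂ Φ z b) +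
        fderiv ℝ f (Φ z) (fderiv ℂ (fderiv ℂ Φ) z a b) := by
    intro a b
    have hΦr : ContDiffAt ℝ 2 Φ z := hΦ.restrict_scalars ℝ
    have h : fderiv ℝ (f ∘ Φ) =ᶠ[𝓝 z] fun y => (fderiv ℝ f (Φ y)).comp (fderiv ℝ Φ y) := by
      filter_upwards [hΦr.eventually (by simp),
        hΦ.continuousAt.eventually (hf.eventually (by simp))] with y hy hy'
      exact fderiv_comp y (hy'.differentiableAt (by simp)) (hy.differentiableAt (by simp))
    have h1 : HasFDerivAt (fderiv ℝ f) (fderiv ℝ (fderiv ℝ f) (Φ z)) (Φ z) :=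
      ((hf.fderiv_right (m := 1) le_rfl).differentiableAt (by simp)).hasFDerivAt
    have h2 : HasFDerivAt (fderiv ℝ Φ) (fderiv ℝ (fderiv ℝ Φ) z) z :=
      ((hΦr.fderiv_right (m := 1) le_rfl).differentiableAt (by simp)).hasFDerivAt
    have h3 : HasFDerivAt Φ (fderiv ℝ Φ z) z := (hΦr.differentiableAt (by simp)).hasFDerivAt
    have hr : fderiv ℝ Φ z = (fderiv ℂ Φ z).restrictScalars ℝ :=
      (hΦ.differentiableAt (by simp)).fderiv_restrictScalars ℝ
    have h4 : HasFDerivAt (fun y => (fderiv ℝ f (Φ y)).comp (fderiv ℝ Φ y)) _ z :=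
      (h1.comp z h3).clm_comp h2
    rw [h.fderiv_eq, h4.fderiv]
    simp only [add_apply, ContinuousLinearMap.comp_apply,
      ContinuousLinearMap.compL_apply, ContinuousLinearMap.flip_apply, Function.comp_apply,
      fderiv_real_fderiv_real hΦ, hr, ContinuousLinearMap.coe_restrictScalars']
    ring
  -- The second-order term of the chain rule drops out: the second derivative of `Φ` is complex
  -- bilinear, so its values at `(u, v)` and `(I u, I v)` are opposite and those at `(u, I v)` and
  -- `(I u, v)` agree.
  simp only [complexHessian, key, map_smul, smul_apply]
  rw [smul_smul, Complex.I_mul_I, neg_one_smul, map_neg]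
  push_cast
  ring

theorem contDiff_re : ContDiff ℝ 2 (fun z : ℂ => z.re) := Complex.reCLM.contDiff

/-- Real parts of holomorphic functions are pluriharmonic. -/
theorem complexHessian_re {h : F → ℂ} {z : F} (hh : ContDiffAt ℂ 2 h z) (u v : F) :
    complexHessian (fun y => (h y).re) z u v = 0 := by
  have h0 : fderiv ℝ (fun z : ℂ => z.re) = fun _ => Complex.reCLM :=
    funext fun _ => Complex.reCLM.fderiv
  have := complexHessian_comp (f := fun z : ℂ => z.re) contDiff_re.contDiffAt hh u v
  rw [show (fun y => (h y).re) = (fun z : ℂ => z.re) ∘ h from rfl, this]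
  simp [complexHessian, h0]

end Analysis

/-! ### Holomorphic maps, Levi forms and pluriharmonic functions in preferred charts. -/

section Coordinates

variable {F H F' H' : Type*} [NormedAddCommGroup F] [NormedSpace ℂ F]
  [NormedAddCommGroup F'] [NormedSpace ℂ F']
  [TopologicalSpace H] {I : ModelWithCorners ℂ F H} [I.Boundaryless]
  [TopologicalSpace H'] {I' : ModelWithCorners ℂ F' H'}
  {X : Type*} [TopologicalSpace X] [ChartedSpace H X]
  {Y : Type*} [TopologicalSpace Y] [ChartedSpace H' Y]

omit [I.Boundaryless] in
theorem eventually_extChartAt_symm {x : X} {p : X → Prop} (h : ∀ᶠ y in 𝓝 x, p y) :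
    ∀ᶠ z in 𝓝 (extChartAt I x x), p ((extChartAt I x).symm z) :=
  (continuousAt_extChartAt_symm x).eventually (by simpa using h)

theorem eventually_extChartAt_right_inv (x : X) :
    ∀ᶠ z in 𝓝 (extChartAt I x x), extChartAt I x ((extChartAt I x).symm z) = z := by
  filter_upwards [extChartAt_target_mem_nhds (I := I) x] with z hz
  exact (extChartAt I x).right_inv hz

/-- A map which is given by `g` in the preferred charts is holomorphic if `g` is, and its
differential is that of `g`. -/
theorem contMDiffAt_and_mfderiv_of_eventually {Φ : X → Y} {x : X} {g : F → F'}
    (h : ∀ᶠ y in 𝓝 x, Φ y ∈ (extChartAt I' (Φ x)).source ∧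
      extChartAt I' (Φ x) (Φ y) = g (extChartAt I x y))
    (hg : ContDiffAt ℂ ω g (extChartAt I x x)) :
    ContMDiffAt I I' ω Φ x ∧ mfderiv I I' Φ x = fderiv ℂ g (extChartAt I x x) := by
  have hw : writtenInExtChartAt I I' x Φ =ᶠ[𝓝 (extChartAt I x x)] g := by
    filter_upwards [eventually_extChartAt_symm (I := I) h, eventually_extChartAt_right_inv x]
      with z hz hz'
    simp only [writtenInExtChartAt, Function.comp_apply]
    rw [hz.2, hz']
  have hgx : g (extChartAt I x x) = extChartAt I' (Φ x) (Φ x) := h.self_of_nhds.2.symm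
  -- Continuity is not assumed: because nearby values stay in the chart source, `Φ` is recovered as
  -- the inverse chart applied to `g`.
  have hc : ContinuousAt Φ x := by
    have h1 : ContinuousAt (fun y => (extChartAt I' (Φ x)).symm (g (extChartAt I x y))) x := by
      refine ContinuousAt.comp (g := (extChartAt I' (Φ x)).symm) ?_
        (ContinuousAt.comp (g := g) hg.continuousAt (continuousAt_extChartAt x))
      rw [hgx]
      exact continuousAt_extChartAt_symm _
    refine h1.congr ?_
    filter_upwards [h] with y hy
    rw [← hy.2, (extChartAt I' (Φ x)).left_inv hy.1]
  have hs : ContMDiffAt I I' ω Φ x := by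
    rw [contMDiffAt_iff, I.range_eq_univ, contDiffWithinAt_univ]
    exact ⟨hc, hg.congr_of_eventuallyEq hw⟩
  refine ⟨hs, ?_⟩
  rw [(hs.mdifferentiableAt (by simp)).mfderiv, I.range_eq_univ, fderivWithin_univ, hw.fderiv_eq]

/-- Inserting the chart at `Φ x` turns `f ∘ Φ` into a function on a vector space composed with the
holomorphic coordinate expression of `Φ`, so `complexHessian_comp` applies. -/
theorem leviForm_comp {f : Y → ℝ} {Φ : X → Y} {x : X}
    (hf : ContDiffAt ℝ 2 (f ∘ (extChartAt I' (Φ x)).symm) (extChartAt I' (Φ x) (Φ x)))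
    (hΦ : ContMDiffAt I I' ω Φ x) (u v : TangentSpace I x) :
    leviForm I (f ∘ Φ) x u v = leviForm I' f (Φ x) (mfderiv I I' Φ x u) (mfderiv I I' Φ x v) := by
  have hs := (contMDiffAt_iff.1 hΦ).2
  rw [I.range_eq_univ, contDiffWithinAt_univ] at hs
  have hx : (extChartAt I' (Φ x) ∘ Φ ∘ (extChartAt I x).symm) (extChartAt I x x) =
      extChartAt I' (Φ x) (Φ x) := by simp
  have he : (f ∘ Φ) ∘ (extChartAt I x).symm =ᶠ[𝓝 (extChartAt I x x)]
      (f ∘ (extChartAt I' (Φ x)).symm) ∘ (extChartAt I' (Φ x) ∘ Φ ∘ (extChartAt I x).symm) := by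
    have h1 : ∀ᶠ y in 𝓝 x, Φ y ∈ (extChartAt I' (Φ x)).source :=
      hΦ.continuousAt.eventually (extChartAt_source_mem_nhds (I := I') (Φ x))
    filter_upwards [eventually_extChartAt_symm (I := I) h1] with z hz
    simp only [Function.comp_apply]
    rw [(extChartAt I' (Φ x)).left_inv hz]
  rw [(hΦ.mdifferentiableAt (by simp)).mfderiv, I.range_eq_univ, fderivWithin_univ]
  refine (complexHessian_congr he _ _).trans ?_
  refine (complexHessian_comp (by rwa [hx]) (hs.of_le (by simp)) _ _).trans ?_
  rw [hx]
  rfl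

omit [I.Boundaryless] in
theorem leviForm_add {f g : X → ℝ} {x : X}
    (hf : ContDiffAt ℝ 2 (f ∘ (extChartAt I x).symm) (extChartAt I x x))
    (hg : ContDiffAt ℝ 2 (g ∘ (extChartAt I x).symm) (extChartAt I x x))
    (u v : TangentSpace I x) :
    leviForm I (f + g) x u v = leviForm I f x u v + leviForm I g x u v :=
  complexHessian_add hf hg u v

/-- A holomorphic map preserves the Levi form of a potential which it changes by a
pluriharmonic function. -/
theorem leviForm_eq_of_isPluriharmonic {f : X → ℝ} {Φ : X → X}
    (hf : ∀ x, ContDiffAt ℝ 2 (f ∘ (extChartAt I x).symm) (extChartAt I x x))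
    (hΦ : ContMDiff I I ω Φ) (h : IsPluriharmonic I (fun x => f (Φ x) - f x))
    (x : X) (u v : TangentSpace I x) :
    leviForm I f (Φ x) (mfderiv I I Φ x u) (mfderiv I I Φ x v) = leviForm I f x u v := by
  rw [← leviForm_comp (hf _) (hΦ x),
    show f ∘ Φ = f + fun x => f (Φ x) - f x by ext; simp,
    leviForm_add (hf x) (h x).1, (h x).2, add_zero]

/-- A function which is the real part of a holomorphic function in the preferred charts is
pluriharmonic. -/
theorem isPluriharmonic_of_eventually {f : X → ℝ}
    (h : ∀ x, ∃ g : F → ℂ, ContDiffAt ℂ ω g (extChartAt I x x) ∧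
      ∀ᶠ y in 𝓝 x, f y = (g (extChartAt I x y)).re) : IsPluriharmonic I f := by
  intro x
  obtain ⟨g, hg, hfg⟩ := h x
  have he : f ∘ (extChartAt I x).symm =ᶠ[𝓝 (extChartAt I x x)] fun z => (g z).re := by
    filter_upwards [eventually_extChartAt_symm (I := I) hfg, eventually_extChartAt_right_inv x]
      with z hz hz'
    rw [Function.comp_apply, hz, hz']
  refine ⟨?_, fun u v => ?_⟩
  · exact (contDiff_re.contDiffAt.comp _
      ((hg.of_le (by simp)).restrict_scalars ℝ)).congr_of_eventuallyEq he
  · exact (complexHessian_congr he _ _).trans (complexHessian_re (hg.of_le (by simp)) _ _)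

end Coordinates

/-! ### Injectivity of the differential of an immersion. -/

section Immersion

variable {E V : Type*} [NormedAddCommGroup E] [NormedSpace ℂ E]
  [NormedAddCommGroup V] [NormedSpace ℂ V]
  {M : Type*} [TopologicalSpace M] [ChartedSpace E M]

/-- In adapted charts an immersion is the inclusion of a factor. Projecting back onto that factor
gives a holomorphic local left inverse, and the chain rule does the rest. -/
theorem mfderiv_injective_of_isImmersion {f : M → V} (hf : IsImmersion 𝓘(ℂ, E) 𝓘(ℂ, V) ω f)
    (m : M) : Function.Injective (mfderiv 𝓘(ℂ, E) 𝓘(ℂ, V) f m) := by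
  have h := hf.isImmersionAt m
  obtain ⟨φ, ψ, e, hm, hfm, hφA, hψA, hw⟩ : ∃ (φ : OpenPartialHomeomorph M E)
      (ψ : OpenPartialHomeomorph V V) (e : (E × h.complement) ≃L[ℂ] V),
      m ∈ φ.source ∧ f m ∈ ψ.source ∧ φ ∈ IsManifold.maximalAtlas 𝓘(ℂ, E) ω M ∧
      ψ ∈ IsManifold.maximalAtlas 𝓘(ℂ, V) ω V ∧
      Set.EqOn (ψ.extend 𝓘(ℂ, V) ∘ f ∘ (φ.extend 𝓘(ℂ, E)).symm) (e ∘ (·, 0))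
        (φ.extend 𝓘(ℂ, E)).target :=
    ⟨h.domChart, h.codChart, h.equiv, h.mem_domChart_source, h.mem_codChart_source,
      h.domChart_mem_maximalAtlas, h.codChart_mem_maximalAtlas, h.writtenInCharts⟩
  set L : V →L[ℂ] E := ContinuousLinearMap.fst ℂ E h.complement ∘L
    (e.symm : V →L[ℂ] E × h.complement)
  have he : ∀ y ∈ φ.source, L (ψ (f y)) = φ y := by
    intro y hy
    have h1 : ψ (f (φ.symm (φ y))) = e (φ y, 0) :=
      hw (by simpa using φ.map_source hy)
    rw [φ.left_inv hy] at h1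
    simp [L, h1]
  have hψ : ContMDiffAt 𝓘(ℂ, V) 𝓘(ℂ, V) ω ψ (f m) :=
    contMDiffAt_of_mem_maximalAtlas hψA hfm
  have hφs : ContMDiffAt 𝓘(ℂ, E) 𝓘(ℂ, E) ω φ.symm (L (ψ (f m))) := by
    rw [he m hm]
    exact contMDiffAt_symm_of_mem_maximalAtlas hφA (φ.map_source hm)
  have hr : MDifferentiableAt 𝓘(ℂ, V) 𝓘(ℂ, E) (fun v => φ.symm (L (ψ v))) (f m) :=
    (hφs.comp (f m) (L.contMDiff.contMDiffAt.comp (f m) hψ)).mdifferentiableAt (by simp)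
  have hinv : (fun v => φ.symm (L (ψ v))) ∘ f =ᶠ[𝓝 m] id := by
    filter_upwards [φ.open_source.mem_nhds hm] with y hy
    rw [Function.comp_apply, he y hy]
    exact φ.left_inv hy
  have hM : MDifferentiableAt 𝓘(ℂ, E) 𝓘(ℂ, V) f m := h.contMDiffAt.mdifferentiableAt (by simp)
  have h1 := mfderiv_comp m hr hM
  rw [hinv.mfderiv_eq, mfderiv_id] at h1
  intro u v huv
  exact (DFunLike.congr_fun h1 u).trans
    ((congrArg (mfderiv 𝓘(ℂ, V) 𝓘(ℂ, E) (fun v => φ.symm (L (ψ v))) (f m)) huv).trans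
      (DFunLike.congr_fun h1 v).symm)

end Immersion

/-! ### Linear algebra of `(V, ω, τ)` and of Lagrangean splittings. -/

section LinearAlgebra

variable {V : Type*} [AddCommGroup V] [Module ℂ V] {D : FundamentalData V}

theorem omega_swap (D : FundamentalData V) (u v : V) : D.omega u v = -D.omega v u := by
  have h := D.omega_alt (u + v)
  simp only [map_add, LinearMap.add_apply, D.omega_alt, zero_add, add_zero] at h
  exact eq_neg_of_add_eq_zero_right h

theorem tau_add_self (D : FundamentalData V) (u : V) : D.tau (u + D.tau u) = u + D.tau u := by
  rw [map_add, D.tau_tau, add_comm]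

theorem tau_I_smul_sub (D : FundamentalData V) (u : V) :
    D.tau (Complex.I • (u - D.tau u)) = Complex.I • (u - D.tau u) := by
  rw [map_smulₛₗ, map_sub, D.tau_tau, Complex.conj_I, neg_smul, ← smul_neg, neg_sub]

theorem eq_real_add_I_smul (D : FundamentalData V) (u : V) :
    u = (1 / 2 : ℂ) • (u + D.tau u) - (Complex.I / 2) • (Complex.I • (u - D.tau u)) := by
  rw [smul_smul, show Complex.I / 2 * Complex.I = -(1 / 2) by
    rw [div_mul_eq_mul_div, Complex.I_mul_I, neg_div], neg_smul, sub_neg_eq_add, ← smul_add,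
    add_add_sub_cancel, ← two_smul ℂ u, smul_smul]
  norm_num

/-- The vectors `u + τ u` and `√-1 (u - τ u)` are real, and likewise for `v`. Reality of `ω` on the
four resulting pairs gives four linear equations, from which the two components of the identity
follow. -/
theorem omega_tau (D : FundamentalData V) (u v : V) :
    D.omega (D.tau u) (D.tau v) = starRingEnd ℂ (D.omega u v) := by
  have h1 := D.omega_real _ _ (tau_add_self D u) (tau_add_self D v)
  have h2 := D.omega_real _ _ (tau_I_smul_sub D u) (tau_I_smul_sub D v)
  have h3 := D.omega_real _ _ (tau_add_self D u) (tau_I_smul_sub D v)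
  have h4 := D.omega_real _ _ (tau_I_smul_sub D u) (tau_add_self D v)
  simp only [map_add, map_sub, map_smul, LinearMap.add_apply, LinearMap.sub_apply,
    LinearMap.smul_apply, smul_eq_mul, Complex.add_im, Complex.mul_im, Complex.sub_im,
    Complex.I_re, Complex.I_im, Complex.mul_re, Complex.sub_re, Complex.add_re] at h1 h2 h3 h4
  apply Complex.ext
  · rw [Complex.conj_re]; linarith
  · rw [Complex.conj_im]; linarith

theorem gammaForm_conj (D : FundamentalData V) (u v : V) :
    starRingEnd ℂ (gammaForm D u v) = gammaForm D v u := by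
  rw [gammaForm, gammaForm, map_mul, ← omega_tau, D.tau_tau, Complex.conj_I,
    omega_swap D (D.tau u), neg_mul_neg]

theorem gammaForm_add_left (u v w : V) :
    gammaForm D (u + v) w = gammaForm D u w + gammaForm D v w := by
  simp [gammaForm, mul_add]

theorem gammaForm_add_right (u v w : V) :
    gammaForm D u (v + w) = gammaForm D u v + gammaForm D u w := by
  simp [gammaForm, mul_add]

/-- Invariance of `L` under `τ` puts the real and imaginary parts of its vectors in `L₀`, where `ω`
vanishes; complex bilinearity then extends this to `L`. -/
theorem omega_eq_zero_of_mem_L (S : LagrangeanSplitting D) {u v : V} (hu : u ∈ S.L)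
    (hv : v ∈ S.L) : D.omega u v = 0 := by
  have hL : ∀ a ∈ S.L₀, ∀ b ∈ S.L₀, D.omega a b = 0 := fun a ha =>
    (S.lagrangean.2 a (S.lagrangean.1 ha)).1 ha
  have h1 : ∀ w ∈ S.L, w + D.tau w ∈ S.L₀ := fun w hw =>
    (S.mem_L₀ _).2 ⟨S.L.add_mem hw ((S.tau_L w).1 hw), tau_add_self D w⟩
  have h2 : ∀ w ∈ S.L, Complex.I • (w - D.tau w) ∈ S.L₀ := fun w hw =>
    (S.mem_L₀ _).2 ⟨S.L.smul_mem _ (S.L.sub_mem hw ((S.tau_L w).1 hw)), tau_I_smul_sub D w⟩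
  rw [eq_real_add_I_smul D u, eq_real_add_I_smul D v]
  simp only [map_sub, map_smul _ (1 / 2 : ℂ), map_smul _ (Complex.I / 2), LinearMap.sub_apply,
    LinearMap.smul_apply, hL _ (h1 u hu) _ (h1 v hv), hL _ (h1 u hu) _ (h2 v hv),
    hL _ (h2 u hu) _ (h1 v hv), hL _ (h2 u hu) _ (h2 v hv), smul_zero, sub_zero]

/-- The Lagrangean splitting with the two summands exchanged. -/
def LagrangeanSplitting.swap (S : LagrangeanSplitting D) : LagrangeanSplitting D where
  L₀ := S.L₀'
  L₀' := S.L₀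
  lagrangean := S.lagrangean'
  lagrangean' := S.lagrangean
  disjoint_real := by rw [inf_comm, S.disjoint_real]
  sup_real := by rw [sup_comm, S.sup_real]
  L := S.L'
  L' := S.L
  isCompl := S.isCompl.symm
  tau_L := S.tau_L'
  tau_L' := S.tau_L
  mem_L₀ := S.mem_L₀'
  mem_L₀' := S.mem_L₀

theorem omega_eq_zero_of_mem_L' (S : LagrangeanSplitting D) {u v : V} (hu : u ∈ S.L')
    (hv : v ∈ S.L') : D.omega u v = 0 :=
  omega_eq_zero_of_mem_L S.swap hu hv

theorem proj_eq_iff (S : LagrangeanSplitting D) (u v : V) :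
    S.proj u = S.proj v ↔ u - v ∈ S.L' := by
  rw [← sub_eq_zero, ← map_sub]
  exact Submodule.projectionOnto_apply_eq_zero_iff S.isCompl

theorem proj_tau (S : LagrangeanSplitting D) (u : V) : S.proj (D.tau u) = S.tauL (S.proj u) := by
  have h : u - S.proj u ∈ S.L' := by
    rw [← proj_eq_iff]
    exact (Submodule.projectionOnto_apply_left S.isCompl (S.proj u)).symm
  have h' : D.tau u - D.tau (S.proj u) ∈ S.L' := by
    rw [← map_sub]
    exact (S.tau_L' _).1 h
  rw [← proj_eq_iff] at h'
  rw [h']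
  exact Submodule.projectionOnto_apply_left S.isCompl (S.tauL (S.proj u))

theorem tauL_tauL (S : LagrangeanSplitting D) (u : S.L) : S.tauL (S.tauL u) = u :=
  Subtype.ext (D.tau_tau u)

section Dimension

variable [FiniteDimensional ℂ V]

theorem finrank_add_finrank_orthogonal (D : FundamentalData V) (W : Submodule ℂ V) :
    Module.finrank ℂ W +
      Module.finrank ℂ (LinearMap.BilinForm.orthogonal (D.omega : LinearMap.BilinForm ℂ V) W) =
      Module.finrank ℂ V := by
  have hB : (D.omega : LinearMap.BilinForm ℂ V).Nondegenerate := by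
    refine ⟨D.omega_nondeg, fun v hv => D.omega_nondeg v fun u => ?_⟩
    rw [omega_swap, hv, neg_zero]
  have := LinearMap.BilinForm.finrank_orthogonal hB W
  have := W.finrank_le
  omega

theorem two_mul_finrank_of_isLagrangean {W : Submodule ℂ V} (h : IsLagrangean D W) :
    2 * Module.finrank ℂ W = Module.finrank ℂ V := by
  have h1 : LinearMap.BilinForm.orthogonal (D.omega : LinearMap.BilinForm ℂ V) W = W := by
    ext v
    rw [h v]
    refine forall₂_congr fun w _ => ?_
    rw [omega_swap, neg_eq_zero]
  have h2 := finrank_add_finrank_orthogonal D W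
  rw [h1] at h2
  omega

theorem two_mul_finrank_L_le (S : LagrangeanSplitting D) :
    2 * Module.finrank ℂ S.L ≤ Module.finrank ℂ V := by
  have h1 : S.L ≤ LinearMap.BilinForm.orthogonal (D.omega : LinearMap.BilinForm ℂ V) S.L :=
    fun v hv w hw => omega_eq_zero_of_mem_L S hw hv
  have := Submodule.finrank_mono h1
  have := finrank_add_finrank_orthogonal D S.L
  omega

/-- Both summands are isotropic, so neither exceeds half the dimension; being complementary, each
attains it. -/
theorem two_mul_finrank_L (S : LagrangeanSplitting D) :
    2 * Module.finrank ℂ S.L = Module.finrank ℂ V := by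
  have h1 := two_mul_finrank_L_le S
  have h2 : 2 * Module.finrank ℂ S.L' ≤ Module.finrank ℂ V := two_mul_finrank_L_le S.swap
  have h3 := Submodule.finrank_add_eq_of_isCompl S.isCompl
  omega

end Dimension

/-- The decomposition of `V` into real and imaginary parts. -/
def realEquiv (D : FundamentalData V) : (realPoints D × realPoints D) ≃ₗ[ℝ] V where
  toFun a := (a.1 : V) + Complex.I • (a.2 : V)
  map_add' a b := by
    simp only [Prod.fst_add, Prod.snd_add, Submodule.coe_add, smul_add]
    abel
  map_smul' c a := by
    simp only [Prod.smul_fst, Prod.smul_snd, Submodule.coe_smul, RingHom.id_apply, smul_add,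
      smul_comm Complex.I c]
  invFun v := (⟨(1 / 2 : ℝ) • (v + D.tau v), Submodule.smul_mem _ _ (tau_add_self D v)⟩,
    ⟨(-1 / 2 : ℝ) • (Complex.I • (v - D.tau v)), Submodule.smul_mem _ _ (tau_I_smul_sub D v)⟩)
  left_inv := by
    rintro ⟨⟨a, ha⟩, ⟨b, hb⟩⟩
    have ha' : D.tau a = a := ha
    have hb' : D.tau b = b := hb
    ext
    · simp only [map_add, map_smulₛₗ, ha', hb', Complex.conj_I, ← Complex.coe_smul]
      module
    · simp only [map_add, map_smulₛₗ, ha', hb', Complex.conj_I, ← Complex.coe_smul]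
      rw [show a + Complex.I • b - (a + -Complex.I • b) = (2 * Complex.I) • b by module, smul_smul,
        smul_smul, show ((-1 / 2 : ℝ) : ℂ) * Complex.I * (2 * Complex.I) = 1 by
          push_cast; linear_combination -Complex.I_mul_I, one_smul]
  right_inv v := by
    simp only [← Complex.coe_smul]
    conv_rhs => rw [eq_real_add_I_smul D v]
    push_cast
    module

theorem finrank_realPoints [FiniteDimensional ℂ V] (D : FundamentalData V) :
    Module.finrank ℝ (realPoints D) = Module.finrank ℂ V := by
  have : FiniteDimensional ℝ V := FiniteDimensional.complexToReal V
  have h := (realEquiv D).finrank_eq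
  rw [Module.finrank_prod, finrank_real_of_complex] at h
  omega

end LinearAlgebra

/-! ### The pointwise model: a linear map onto a Lagrangean subspace in general position. -/

section Adapted

variable {V : Type*} [AddCommGroup V] [Module ℂ V] {D : FundamentalData V}
  {T : Type*} [AddCommGroup T] [Module ℂ T]

/-- A linear map `A : T → V` is adapted to a splitting `V = L ⊕ L'` if its image is a Lagrangean
subspace on which `γ` is nondegenerate and if `p ∘ A : T → L` is an isomorphism. -/
structure IsAdapted (S : LagrangeanSplitting D) (A : T →ₗ[ℂ] V) : Prop where
  lagrangean : ∀ v, v ∈ LinearMap.range A ↔ ∀ u, D.omega v (A u) = 0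
  nondegenerate : ∀ u, (∀ v, gammaForm D (A u) (A v) = 0) → A u = 0
  bijective : Function.Bijective (S.proj ∘ₗ A)

/-- The covector `√-1 ω(v, A ·)` as a function of `v ∈ V^τ`. -/
def realPsi (D : FundamentalData V) (A : T →ₗ[ℂ] V) : realPoints D →ₗ[ℝ] (T →ₗ[ℂ] ℂ) where
  toFun v := Complex.I • (D.omega v ∘ₗ A)
  map_add' u v := by
    ext
    simp [mul_add]
  map_smul' c v := by
    ext
    simp only [Submodule.coe_smul, ← Complex.coe_smul, map_smul, LinearMap.smul_apply,
      LinearMap.comp_apply, smul_eq_mul, RingHom.id_apply]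
    ring

namespace IsAdapted

variable {S : LagrangeanSplitting D} {A : T →ₗ[ℂ] V} (hA : IsAdapted S A)

include hA

theorem injective : Function.Injective A := fun _ _ h => hA.bijective.1 (congrArg S.proj h)

theorem omega_eq_zero (u v : T) : D.omega (A u) (A v) = 0 :=
  (hA.lagrangean (A u)).1 ⟨u, rfl⟩ v

/-- Only the image and the bijectivity of `p ∘ A` matter. This carries adaptedness from `T_m M` to
the model space `E` through a chart frame. -/
theorem comp_equiv {T' : Type*} [AddCommGroup T'] [Module ℂ T'] (e : T' ≃ₗ[ℂ] T) :
    IsAdapted S (A ∘ₗ e.toLinearMap) where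
  lagrangean v := by
    rw [LinearMap.range_comp, LinearEquiv.range, Submodule.map_top, hA.lagrangean]
    exact e.surjective.forall
  nondegenerate u hu := hA.nondegenerate _ (e.surjective.forall.2 hu)
  bijective := hA.bijective.comp e.bijective

theorem eq_of_gammaForm_eq {s t : T}
    (h : ∀ u, gammaForm D (A u) (A s) = gammaForm D (A u) (A t)) : s = t := by
  rw [← sub_eq_zero]
  apply hA.injective
  rw [map_zero]
  refine hA.nondegenerate _ fun v => ?_
  rw [← gammaForm_conj, map_eq_zero]
  have := h v
  simp only [gammaForm, map_sub, mul_sub] at this ⊢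
  rw [this, sub_self]

/-- A vector in the kernel is `ω`-orthogonal to the Lagrangean image, hence lies in it. Being real,
it is then `γ`-orthogonal to the image as well, and nondegeneracy kills it. -/
theorem realPsi_injective : Function.Injective (realPsi D A) := by
  rw [← LinearMap.ker_eq_bot, LinearMap.ker_eq_bot']
  rintro ⟨v, hv⟩ h
  have hv' : D.tau v = v := hv
  have h1 : ∀ u, D.omega v (A u) = 0 := fun u => by
    have := LinearMap.congr_fun h u
    simpa [realPsi] using this
  obtain ⟨u, rfl⟩ := (hA.lagrangean v).2 h1
  refine Subtype.ext (hA.nondegenerate u fun w => ?_)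
  rw [← gammaForm_conj, gammaForm, hv', omega_swap, h1]
  simp

theorem finrank_eq [FiniteDimensional ℂ V] :
    2 * Module.finrank ℂ T = Module.finrank ℂ V := by
  rw [(LinearEquiv.ofBijective _ hA.bijective).finrank_eq, two_mul_finrank_L]

/-- The real dimension of `V^τ` is the complex dimension of `V`, which is twice that of `T`, that
is, the real dimension of the dual of `T`. -/
theorem realPsi_bijective [FiniteDimensional ℂ V] [FiniteDimensional ℂ T] :
    Function.Bijective (realPsi D A) := by
  have : FiniteDimensional ℝ V := FiniteDimensional.complexToReal V
  have : FiniteDimensional ℝ (T →ₗ[ℂ] ℂ) := FiniteDimensional.complexToReal _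
  refine ⟨hA.realPsi_injective,
    (LinearMap.injective_iff_surjective_of_finrank_eq_finrank ?_).1 hA.realPsi_injective⟩
  rw [finrank_realPoints, finrank_real_of_complex, Module.finrank_linearMap, Module.finrank_self,
    mul_one, hA.finrank_eq]

/-- For real `v`, the covector `σ + ρ σ` defined by `σ = √-1 ω(v, A ·)` is dual, up to the sign,
to the vector `x` with `p (A x) = p v`. -/
theorem realPsi_add_conj {v : V} (hv : D.tau v = v) {x u y : T}
    (hx : S.proj (A x) = S.proj v) (hy : S.proj (A y) = S.tauL (S.proj (A u))) :
    Complex.I * D.omega v (A u) + starRingEnd ℂ (Complex.I * D.omega v (A y)) =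
      -gammaForm D (A u) (A x) := by
  have hl : A u - D.tau (A y) ∈ S.L' := by
    rw [← proj_eq_iff, proj_tau, hy, tauL_tauL]
  have hxv : v - D.tau (A x) ∈ S.L' := by
    rw [← proj_eq_iff, proj_tau, hx, ← proj_tau, hv]
  -- Expanding this zero expresses `ω(v, A u) - ω(v, τ A y)` as `ω(τ A x, A u)`; the fourth term
  -- vanishes because the image of `A` is isotropic.
  have h1 := omega_eq_zero_of_mem_L' S hxv hl
  have h2 : D.omega (D.tau (A x)) (D.tau (A y)) = 0 := by
    rw [omega_tau, hA.omega_eq_zero, map_zero]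
  rw [map_mul, Complex.conj_I, ← omega_tau, hv, gammaForm, omega_swap D (A u)]
  simp only [map_sub, LinearMap.sub_apply, h2] at h1
  linear_combination Complex.I * h1

end IsAdapted

end Adapted

/-! ### The potential on a single cotangent fibre. -/

section Pointwise

variable {V : Type*} [NormedAddCommGroup V] [NormedSpace ℂ V] [FiniteDimensional ℂ V]
  {D : FundamentalData V} {S : LagrangeanSplitting D}
  {E : Type*} [NormedAddCommGroup E] [NormedSpace ℂ E] [FiniteDimensional ℂ E]
  {M : Type*} [TopologicalSpace M] [ChartedSpace E M]
  {ι : M → V}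

/-- The projection `p : V → L` as a continuous linear map. -/
def projL (S : LagrangeanSplitting D) : V →L[ℂ] S.L := LinearMap.toContinuousLinearMap S.proj

omit [FiniteDimensional ℂ V] [FiniteDimensional ℂ E] in
theorem IsLagrangeanPseudoKahler.contMDiff (hM : IsLagrangeanPseudoKahler (E := E) D S ι) :
    ContMDiff 𝓘(ℂ, E) 𝓘(ℂ, V) ω ι := hM.embedding.contMDiff

omit [FiniteDimensional ℂ V] [FiniteDimensional ℂ E] in
theorem IsLagrangeanPseudoKahler.mdifferentiableAt
    (hM : IsLagrangeanPseudoKahler (E := E) D S ι) (m : M) :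
    MDifferentiableAt 𝓘(ℂ, E) 𝓘(ℂ, V) ι m := (hM.contMDiff m).mdifferentiableAt (by simp)

/-- General position makes `p` injective on `T_m M`; it is onto `L` because both spaces have half
the dimension of `V`. -/
theorem IsLagrangeanPseudoKahler.isAdapted (hM : IsLagrangeanPseudoKahler (E := E) D S ι)
    (m : M) : IsAdapted S (dincl (E := E) ι m).toLinearMap := by
  have hinj : Function.Injective (S.proj ∘ₗ (dincl (E := E) ι m).toLinearMap) := by
    have h := mfderiv_injective_of_isImmersion hM.generalPosition.isImmersion m
    have hc := mfderiv_comp m (g := projL S) (projL S).mdifferentiableAt (hM.mdifferentiableAt m)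
    rw [(projL S).mfderiv_eq] at hc
    intro u v huv
    apply h
    change mfderiv 𝓘(ℂ, E) 𝓘(ℂ, S.L) (projL S ∘ ι) m u =
      mfderiv 𝓘(ℂ, E) 𝓘(ℂ, S.L) (projL S ∘ ι) m v
    rw [hc]
    exact huv
  have hlag := hM.lagrangean m
  refine ⟨fun v => (hlag v).trans ?_, fun u hu => ?_, hinj,
    (LinearMap.injective_iff_surjective_of_finrank_eq_finrank ?_).1 hinj⟩
  · exact ⟨fun h u => h _ ⟨u, rfl⟩, by rintro h _ ⟨u, rfl⟩; exact h u⟩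
  · refine hM.nondegenerate m _ ⟨u, rfl⟩ ?_
    rintro _ ⟨v, rfl⟩
    exact hu v
  · have h1 := two_mul_finrank_of_isLagrangean hlag
    rw [LinearMap.finrank_range_of_inj fun _ _ h => hinj (congrArg S.proj h)] at h1
    have h2 := two_mul_finrank_L S
    omega

/-- The tangent vector at `m` with a given image in `L`. -/
def lift (S : LagrangeanSplitting D) (ι : M → V) (m : M) (w : S.L) : TangentSpace 𝓘(ℂ, E) m :=
  (LinearMap.toContinuousLinearMap (dproj S ι m)).inverse w

theorem isInvertible_dproj (hM : IsLagrangeanPseudoKahler (E := E) D S ι) (m : M) :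
    (LinearMap.toContinuousLinearMap (dproj (E := E) S ι m)).IsInvertible :=
  ⟨(LinearEquiv.ofBijective _ (hM.isAdapted m).bijective).toContinuousLinearEquiv, by
    ext; rfl⟩

theorem proj_dincl_lift (hM : IsLagrangeanPseudoKahler (E := E) D S ι) (m : M) (w : S.L) :
    S.proj (dincl ι m (lift (E := E) S ι m w)) = w :=
  (isInvertible_dproj hM m).self_apply_inverse w

theorem proj_dincl_rhoPrime (hM : IsLagrangeanPseudoKahler (E := E) D S ι) (m : M)
    (u : TangentSpace 𝓘(ℂ, E) m) :
    S.proj (dincl ι m (rhoPrime S ι m u)) = S.tauL (S.proj (dincl ι m u)) :=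
  proj_dincl_lift hM m _

theorem exists_eq_psi (hM : IsLagrangeanPseudoKahler (E := E) D S ι) (m : M)
    (σ : TangentSpace 𝓘(ℂ, E) m →L[ℂ] ℂ) :
    ∃ v : realPoints D, σ = Complex.I • psi ι D m v := by
  obtain ⟨v, hv⟩ := (hM.isAdapted m).realPsi_bijective.2 σ.toLinearMap
  refine ⟨v, ?_⟩
  ext u
  exact (LinearMap.congr_fun hv u).symm

theorem psi_injective (hM : IsLagrangeanPseudoKahler (E := E) D S ι) (m : M) {v w : realPoints D}
    (h : Complex.I • psi (E := E) ι D m v = Complex.I • psi ι D m w) : v = w := by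
  apply (hM.isAdapted m).realPsi_injective
  ext u
  exact DFunLike.congr_fun h u

theorem add_rho_apply (hM : IsLagrangeanPseudoKahler (E := E) D S ι) (m : M) (v : realPoints D)
    (u : TangentSpace 𝓘(ℂ, E) m) :
    (Complex.I • psi (E := E) ι D m v + rho S ι m (Complex.I • psi (E := E) ι D m v)) u =
      -metric D ι m u (lift S ι m (S.proj v)) :=
  (hM.isAdapted m).realPsi_add_conj v.2 (proj_dincl_lift hM m _) (proj_dincl_rhoPrime hM m u)

/-- The vector `s` witnesses solvability, so the choice in `sharp` is genuine; nondegeneracy of `γ`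
makes the solution unique. -/
theorem sharp_eq (hM : IsLagrangeanPseudoKahler (E := E) D S ι) (m : M)
    {β : TangentSpace 𝓘(ℂ, E) m →L[ℂ] ℂ} {s : TangentSpace 𝓘(ℂ, E) m}
    (h : ∀ u, metric D ι m u s = β u) : sharp D ι m β = s := by
  refine (hM.isAdapted m).eq_of_gammaForm_eq fun u => ?_
  have h1 : ∀ u, metric D ι m u (sharp D ι m β) = β u :=
    Classical.epsilon_spec (p := fun s => ∀ u, metric D ι m u s = β u) ⟨s, h⟩
  exact (h1 u).trans (h u).symm

/-- The potential of the covector `√-1 ψ_m(v)`. -/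
theorem potential_eq (hM : IsLagrangeanPseudoKahler (E := E) D S ι) (m : M) (v : realPoints D) :
    potential S ι ⟨m, Complex.I • psi (E := E) ι D m v⟩ =
      (gammaForm D (ι m) (ι m) +
        metric (E := E) D ι m (lift S ι m (S.proj v)) (lift S ι m (S.proj v))).re := by
  set x := lift (E := E) S ι m (S.proj v)
  have hs : sharp D ι m (Complex.I • psi (E := E) ι D m v +
      rho S ι m (Complex.I • psi ι D m v)) = -x := by
    refine sharp_eq hM m fun u => ?_
    rw [add_rho_apply hM]
    simp [metric, gammaForm, x]
  have hi : inverseMetric D ι m (Complex.I • psi (E := E) ι D m v + rho S ι m (Complex.I • psi ι D m v))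
      (Complex.I • psi ι D m v + rho S ι m (Complex.I • psi ι D m v)) = metric D ι m x x := by
    rw [inverseMetric, hs, map_neg, add_rho_apply hM, neg_neg]
  exact congrArg (fun c => (gammaForm D (ι m) (ι m) + c).re) hi

theorem metric_lift (hM : IsLagrangeanPseudoKahler (E := E) D S ι) (m : M) (v w : realPoints D) :
    (metric (E := E) D ι m (lift S ι m (S.proj w)) (lift S ι m (S.proj v))).re =
      -2 * (Complex.I * psi (E := E) ι D m v (lift S ι m (S.proj w))).re := by
  set x := lift (E := E) S ι m (S.proj w)
  have hw : D.tau w = w := w.2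
  have h := (hM.isAdapted m).realPsi_add_conj v.2 (proj_dincl_lift hM m _)
    -- Since `w` is real, `x` is fixed by `ρ'`. Hence `σ + ρ σ` at `x` is twice a real part, whence
    -- the factor `2`.
    (u := x) (y := x) (by
      change S.proj (dincl ι m x) = S.tauL (S.proj (dincl ι m x))
      rw [proj_dincl_lift hM, ← proj_tau, hw])
  have h' := congrArg Complex.re h
  rw [Complex.add_re, Complex.conj_re, Complex.neg_re] at h'
  change (Complex.I * psi (E := E) ι D m v x).re + (Complex.I * psi (E := E) ι D m v x).re =
    -(metric (E := E) D ι m x (lift S ι m (S.proj v))).re at h'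
  linarith

/-- The change of the potential under a translation is the real part of a function which is
affine on the fibres. -/
theorem potential_add_sub (hM : IsLagrangeanPseudoKahler (E := E) D S ι) (m : M)
    (σ : TangentSpace 𝓘(ℂ, E) m →L[ℂ] ℂ) (v : realPoints D) :
    potential S ι ⟨m, σ + Complex.I • psi (E := E) ι D m v⟩ - potential S ι ⟨m, σ⟩ =
      (-4 * σ (lift S ι m (S.proj v)) -
        2 * (Complex.I * psi (E := E) ι D m v (lift S ι m (S.proj v)))).re := by
  obtain ⟨w, rfl⟩ := exists_eq_psi hM m σ
  have h1 : Complex.I • psi (E := E) ι D m w + Complex.I • psi ι D m v =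
      Complex.I • psi ι D m (w + v : realPoints D) := by
    ext u
    simp [psi]
  have h2 : lift (E := E) S ι m (S.proj (w + v : realPoints D)) =
      lift S ι m (S.proj w) + lift S ι m (S.proj v) := by
    simp [lift]
  rw [h1, potential_eq hM, potential_eq hM, h2]
  -- The cross terms are evaluated as `g(y, x)`, so that `σ = √-1 ψ(w)` is applied to `y`, which is
  -- independent of `σ`; the vector `x` depends on `σ` only real-linearly. The two cross terms
  -- contribute `-4`, and the term `g(y, y)` contributes `-2`.
  have hwv := metric_lift hM m w v
  have hvv := metric_lift hM m v v
  set x := lift (E := E) S ι m (S.proj w)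
  set y := lift (E := E) S ι m (S.proj v)
  have h3 : metric D ι m (x + y) (x + y) = metric D ι m x x + metric D ι m x y +
      (metric D ι m y x + metric D ι m y y) := by
    simp only [metric, map_add, gammaForm_add_left, gammaForm_add_right]
    ring
  have h4 : (metric D ι m x y).re = (metric D ι m y x).re := by
    rw [metric, ← gammaForm_conj, Complex.conj_re]
    rfl
  rw [h3]
  simp only [Complex.add_re, Complex.sub_re, h4, hwv, hvv, smul_apply, smul_eq_mul]
  rw [show (-4 : ℂ) = ((-4 : ℝ) : ℂ) by norm_num, show (2 : ℂ) = ((2 : ℝ) : ℂ) by norm_num,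
    Complex.re_ofReal_mul, Complex.re_ofReal_mul]
  ring

end Pointwise

/-! ### Frames of `TM` and cotangent coordinates. -/

section CotangentCoordinates

variable {E : Type*} [NormedAddCommGroup E] [NormedSpace ℂ E]
  {M : Type*} [TopologicalSpace M] [ChartedSpace E M] [IsManifold 𝓘(ℂ, E) ω M]
  {W : Type*} [NormedAddCommGroup W] [NormedSpace ℂ W]

/-- The isomorphism `E → T_y M` given by the preferred chart at `m`. -/
def chartFrame (m y : M) : E →L[ℂ] TangentSpace 𝓘(ℂ, E) y :=
  (trivializationAt E (TangentSpace 𝓘(ℂ, E)) m).symmL ℂ y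

/-- The inverse of `chartFrame`. -/
def chartCoframe (m y : M) : TangentSpace 𝓘(ℂ, E) y →L[ℂ] E :=
  (trivializationAt E (TangentSpace 𝓘(ℂ, E)) m).continuousLinearMapAt ℂ y

theorem chartFrame_chartCoframe {m y : M} (hy : y ∈ (chartAt E m).source)
    (u : TangentSpace 𝓘(ℂ, E) y) : chartFrame m y (chartCoframe m y u) = u :=
  Trivialization.symmL_continuousLinearMapAt _ hy u

theorem chartCoframe_chartFrame {m y : M} (hy : y ∈ (chartAt E m).source) (u : E) :
    chartCoframe m y (chartFrame m y u) = u :=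
  Trivialization.continuousLinearMapAt_symmL _ hy u

theorem chartCoframe_eq {m y : M} (hy : y ∈ (chartAt E m).source) :
    chartCoframe (E := E) m y = mfderiv 𝓘(ℂ, E) 𝓘(ℂ, E) (extChartAt 𝓘(ℂ, E) m) y :=
  TangentBundle.continuousLinearMapAt_trivializationAt hy

/-- The differential of `g` in the preferred chart at `m`. -/
theorem mfderiv_chartFrame {g : M → W} {m y : M} (hy : y ∈ (chartAt E m).source)
    (hg : MDifferentiableAt 𝓘(ℂ, E) 𝓘(ℂ, W) g y) (u : E) :
    mfderiv 𝓘(ℂ, E) 𝓘(ℂ, W) g y (chartFrame m y u) =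
      fderiv ℂ (g ∘ (extChartAt 𝓘(ℂ, E) m).symm) (extChartAt 𝓘(ℂ, E) m y) u := by
  have hy' : y ∈ (extChartAt 𝓘(ℂ, E) m).source := by rwa [extChartAt_source]
  have hs : MDifferentiableAt 𝓘(ℂ, E) 𝓘(ℂ, E) (extChartAt 𝓘(ℂ, E) m).symm
      (extChartAt 𝓘(ℂ, E) m y) := by
    have := mdifferentiableWithinAt_extChartAt_symm (I := 𝓘(ℂ, E))
      ((extChartAt 𝓘(ℂ, E) m).map_source hy')
    rwa [modelWithCornersSelf_coe, Set.range_id, mdifferentiableWithinAt_univ] at this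
  have h := mfderiv_comp_of_eq (x := extChartAt 𝓘(ℂ, E) m y) hg hs
    ((extChartAt 𝓘(ℂ, E) m).left_inv hy')
  -- The base points agree only propositionally, so the two differentials are compared as maps on
  -- the model space `E`.
  have hc : ∀ y', y' = y → ∀ e : E, (mfderiv 𝓘(ℂ, E) 𝓘(ℂ, W) g y' : E →L[ℂ] W) e =
      (mfderiv 𝓘(ℂ, E) 𝓘(ℂ, W) g y : E →L[ℂ] W) e := by
    rintro _ rfl _
    rfl
  rw [mfderiv_eq_fderiv] at h
  rw [h, chartFrame, TangentBundle.symmL_trivializationAt hy, modelWithCornersSelf_coe,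
    Set.range_id, mfderivWithin_univ]
  exact (hc _ ((extChartAt 𝓘(ℂ, E) m).left_inv hy') _).symm

/-- The differential of a map between manifolds in preferred charts. -/
theorem mfderiv_chartFrame_eq_chartFrame {f : M → M} {m y : M} (hy : y ∈ (chartAt E m).source)
    {m' : M} (hy' : f y ∈ (chartAt E m').source)
    (hf : MDifferentiableAt 𝓘(ℂ, E) 𝓘(ℂ, E) f y) (u : E) :
    mfderiv 𝓘(ℂ, E) 𝓘(ℂ, E) f y (chartFrame m y u) = chartFrame m' (f y)
      (fderiv ℂ (extChartAt 𝓘(ℂ, E) m' ∘ f ∘ (extChartAt 𝓘(ℂ, E) m).symm)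
        (extChartAt 𝓘(ℂ, E) m y) u) := by
  have he : MDifferentiableAt 𝓘(ℂ, E) 𝓘(ℂ, E) (extChartAt 𝓘(ℂ, E) m') (f y) :=
    mdifferentiableAt_extChartAt hy'
  have h := mfderiv_chartFrame hy (he.comp y hf) u
  rw [mfderiv_comp y he hf, ← chartCoframe_eq hy'] at h
  rw [← chartFrame_chartCoframe hy' (mfderiv 𝓘(ℂ, E) 𝓘(ℂ, E) f y (chartFrame m y u))]
  exact congrArg (chartFrame m' (f y)) h

/-- The target bundle is trivial, so only the frame of `TM` enters: the fibre coordinate of a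
covector is its restriction to the frame. -/
theorem extChartAt_cotangent (x y : Cotangent E M) :
    extChartAt (cotangentModel E) x y =
      (extChartAt 𝓘(ℂ, E) x.1 y.1, y.2 ∘L chartFrame x.1 y.1) := by
  have h := hom_chart (𝕜 := ℂ) (F₁ := E) (E₁ := fun m : M => TangentSpace 𝓘(ℂ, E) m)
    (F₂ := ℂ) (E₂ := Trivial M ℂ) (HB := E) x y
  have h2 : extChartAt (cotangentModel E) x y =
      chartAt (ModelProd E (E →L[ℂ] ℂ)) x y := rfl
  rw [h2, h]
  refine Prod.ext rfl ?_
  ext u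
  simp [ContinuousLinearMap.inCoordinates, chartFrame]

theorem mem_extChartAt_cotangent_source (x y : Cotangent E M) :
    y ∈ (extChartAt (cotangentModel E) x).source ↔ y.1 ∈ (chartAt E x.1).source := by
  rw [extChartAt_source]
  simp only [FiberBundle.chartedSpace_chartAt, mfld_simps]
  exact ⟨fun h => h.1.1, fun h => ⟨⟨h, trivial⟩, h⟩⟩

theorem eventually_mem_chartAt_source (x : Cotangent E M) :
    ∀ᶠ y in 𝓝 x, y.1 ∈ (chartAt E x.1).source := by
  filter_upwards [extChartAt_source_mem_nhds (I := cotangentModel E) x] with y hy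
  exact (mem_extChartAt_cotangent_source x y).1 hy

end CotangentCoordinates

/-! ### Smoothness of the potential. -/

section Potential

variable {V : Type*} [NormedAddCommGroup V] [NormedSpace ℂ V] [FiniteDimensional ℂ V]
  {D : FundamentalData V} {S : LagrangeanSplitting D}
  {E : Type*} [NormedAddCommGroup E] [NormedSpace ℂ E] [FiniteDimensional ℂ E]
  {M : Type*} [TopologicalSpace M] [ChartedSpace E M] [IsManifold 𝓘(ℂ, E) ω M]
  {ι : M → V}

/-- The immersion `ι` in the preferred chart at `m`. -/
def localIncl (E : Type*) [NormedAddCommGroup E] [NormedSpace ℂ E] [ChartedSpace E M]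
    (ι : M → V) (m : M) : E → V := ι ∘ (extChartAt 𝓘(ℂ, E) m).symm

omit [FiniteDimensional ℂ V] [FiniteDimensional ℂ E] in
theorem contDiffAt_localIncl (hM : IsLagrangeanPseudoKahler (E := E) D S ι) {m y : M}
    (hy : y ∈ (chartAt E m).source) :
    ContDiffAt ℂ ω (localIncl E ι m) (extChartAt 𝓘(ℂ, E) m y) := by
  have hz : extChartAt 𝓘(ℂ, E) m y ∈ (extChartAt 𝓘(ℂ, E) m).target :=
    (extChartAt 𝓘(ℂ, E) m).map_source (by rwa [extChartAt_source])
  have h := contMDiffOn_extChartAt_symm (I := 𝓘(ℂ, E)) (n := ω) m _ hz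
  have h' := h.contMDiffAt ((isOpen_extChartAt_target m).mem_nhds hz)
  exact ((hM.contMDiff _).comp _ h').contDiffAt

omit [FiniteDimensional ℂ V] [FiniteDimensional ℂ E] in
theorem contDiffAt_fderiv_localIncl (hM : IsLagrangeanPseudoKahler (E := E) D S ι) {m y : M}
    (hy : y ∈ (chartAt E m).source) :
    ContDiffAt ℂ ω (fderiv ℂ (localIncl E ι m)) (extChartAt 𝓘(ℂ, E) m y) :=
  (contDiffAt_localIncl hM hy).fderiv_right (by simp)

omit [FiniteDimensional ℂ V] [FiniteDimensional ℂ E] in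
theorem dincl_chartFrame (hM : IsLagrangeanPseudoKahler (E := E) D S ι) {m y : M}
    (hy : y ∈ (chartAt E m).source) (u : E) :
    dincl ι y (chartFrame m y u) =
      fderiv ℂ (localIncl E ι m) (extChartAt 𝓘(ℂ, E) m y) u :=
  mfderiv_chartFrame hy (hM.mdifferentiableAt y) u

theorem isAdapted_fderiv_localIncl (hM : IsLagrangeanPseudoKahler (E := E) D S ι) {m y : M}
    (hy : y ∈ (chartAt E m).source) :
    IsAdapted S (fderiv ℂ (localIncl E ι m) (extChartAt 𝓘(ℂ, E) m y)).toLinearMap := by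
  let e : E ≃ₗ[ℂ] TangentSpace 𝓘(ℂ, E) y :=
    LinearEquiv.ofLinearMap (chartFrame m y).toLinearMap (chartCoframe m y).toLinearMap
      (LinearMap.ext fun u => chartFrame_chartCoframe hy u)
      (LinearMap.ext fun u => chartCoframe_chartFrame hy u)
  have h := (hM.isAdapted y).comp_equiv e
  convert h using 1
  ext u
  exact (dincl_chartFrame hM hy u).symm

/-- The inverse of the isomorphism `p ∘ A : E → L`. -/
def localLift (S : LagrangeanSplitting D) (A : E →L[ℂ] V) : S.L →L[ℂ] E :=
  (projL S ∘L A).inverse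

theorem isInvertible_of_isAdapted {A : E →L[ℂ] V} (hA : IsAdapted S A.toLinearMap) :
    (projL S ∘L A).IsInvertible :=
  ⟨(LinearEquiv.ofBijective _ hA.bijective).toContinuousLinearEquiv, by ext; rfl⟩

/-- Inversion is analytic at invertible operators, and adaptedness of `A` is what provides
invertibility. -/
theorem contDiffAt_localLift {A : E →L[ℂ] V} (hA : IsAdapted S A.toLinearMap) :
    ContDiffAt ℂ ω (localLift (E := E) S) A := by
  obtain ⟨e, he⟩ := isInvertible_of_isAdapted hA
  have h : ContDiffAt ℂ ω (ContinuousLinearMap.inverse : (E →L[ℂ] S.L) → S.L →L[ℂ] E)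
      (projL S ∘L A) := by
    rw [← he]
    have : CompleteSpace E := FiniteDimensional.complete ℂ E
    exact contDiffAt_map_inverse e
  exact h.comp A (contDiffAt_const.clm_comp contDiffAt_id)

theorem chartFrame_localLift (hM : IsLagrangeanPseudoKahler (E := E) D S ι) {m y : M}
    (hy : y ∈ (chartAt E m).source) (w : S.L) :
    chartFrame m y (localLift S (fderiv ℂ (localIncl E ι m) (extChartAt 𝓘(ℂ, E) m y)) w) =
      lift S ι y w := by
  apply (hM.isAdapted y).bijective.1
  refine Eq.trans ?_ (proj_dincl_lift hM y w).symm
  change S.proj (dincl ι y (chartFrame m y _)) = w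
  rw [dincl_chartFrame hM hy]
  exact (isInvertible_of_isAdapted (isAdapted_fderiv_localIncl hM hy)).self_apply_inverse w

/-- Real linear coordinates on `V^τ`. -/
def realCoord (D : FundamentalData V) :
    (Fin (Module.finrank ℝ (realPoints D)) → ℝ) ≃ₗ[ℝ] realPoints D :=
  haveI : FiniteDimensional ℝ V := FiniteDimensional.complexToReal V
  (Module.finBasis ℝ (realPoints D)).equivFun.symm

/-- The inclusion `V^τ → V` in real linear coordinates on `V^τ`. -/
def realIncl (D : FundamentalData V) : (Fin (Module.finrank ℝ (realPoints D)) → ℝ) →L[ℝ] V :=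
  LinearMap.toContinuousLinearMap ((realPoints D).subtype ∘ₗ (realCoord D).toLinearMap)

/-- Complex linear coordinates on the dual space of `E`. -/
def dualCoord (E : Type*) [NormedAddCommGroup E] [NormedSpace ℂ E] [FiniteDimensional ℂ E] :
    (E →L[ℂ] ℂ) ≃ₗ[ℂ] (Fin (Module.finrank ℂ E) → ℂ) :=
  LinearMap.toContinuousLinearMap.symm ≪≫ₗ ((Module.finBasis ℂ E).constr ℂ).symm

/-- The covector `√-1 ω(v, A ·)`, in coordinates, as a function of `A : E → V` and `v ∈ V^τ`. -/
def realPsiL (E : Type*) [NormedAddCommGroup E] [NormedSpace ℂ E] [FiniteDimensional ℂ E]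
    (D : FundamentalData V) : (E →L[ℂ] V) →L[ℝ]
      (Fin (Module.finrank ℝ (realPoints D)) → ℝ) →L[ℝ] (Fin (Module.finrank ℂ E) → ℂ) :=
  haveI : FiniteDimensional ℝ (E →L[ℂ] V) := FiniteDimensional.complexToReal _
  LinearMap.toContinuousBilinearMap
    (LinearMap.mk₂ ℝ (fun (A : E →L[ℂ] V) v i =>
      Complex.I * D.omega (realIncl D v) (A (Module.finBasis ℂ E i)))
      (fun A B v => by ext; simp [mul_add])
      (fun c A v => by
        ext
        simp only [Pi.smul_apply, smul_apply, ← Complex.coe_smul, map_smul, smul_eq_mul]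
        ring)
      (fun A v w => by ext; simp [mul_add])
      (fun c A v => by
        ext
        simp only [Pi.smul_apply, map_smul, ← Complex.coe_smul, LinearMap.smul_apply, smul_eq_mul]
        ring))

theorem isInvertible_realPsiL {A : E →L[ℂ] V} (hA : IsAdapted S A.toLinearMap) :
    (realPsiL E D A).IsInvertible := by
  have hb : Function.Bijective (realPsiL E D A) :=
    (((Module.finBasis ℂ E).constr ℂ).symm.bijective (M₂ := Fin (Module.finrank ℂ E) → ℂ)).comp
      (hA.realPsi_bijective.comp (realCoord D).bijective)
  exact ⟨(LinearEquiv.ofBijective (realPsiL E D A).toLinearMap hb).toContinuousLinearEquiv, by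
    ext; rfl⟩

/-- The inverse of `v ↦ √-1 ω(v, A ·)` in coordinates. -/
def localVector (D : FundamentalData V) (A : E →L[ℂ] V) :
    (Fin (Module.finrank ℂ E) → ℂ) →L[ℝ] (Fin (Module.finrank ℝ (realPoints D)) → ℝ) :=
  (realPsiL E D A).inverse

/-- Only real smoothness is asserted, as the operator being inverted is merely real-linear. -/
theorem contDiffAt_localVector {A : E →L[ℂ] V} (hA : IsAdapted S A.toLinearMap) :
    ContDiffAt ℝ ω (localVector (E := E) D) A := by
  obtain ⟨e, he⟩ := isInvertible_realPsiL hA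
  have h : ContDiffAt ℝ ω (ContinuousLinearMap.inverse :
      ((Fin (Module.finrank ℝ (realPoints D)) → ℝ) →L[ℝ] (Fin (Module.finrank ℂ E) → ℂ)) →
        (Fin (Module.finrank ℂ E) → ℂ) →L[ℝ] (Fin (Module.finrank ℝ (realPoints D)) → ℝ))
      (realPsiL E D A) := by
    rw [← he]
    exact contDiffAt_map_inverse e
  exact h.comp A (realPsiL E D).contDiff.contDiffAt

/-- The form `γ` as a continuous real bilinear map. -/
def gammaL (D : FundamentalData V) : V →L[ℝ] V →L[ℝ] ℂ :=
  haveI : FiniteDimensional ℝ V := FiniteDimensional.complexToReal V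
  LinearMap.toContinuousBilinearMap
    (LinearMap.mk₂ ℝ (gammaForm D) gammaForm_add_left
      (fun c u v => by
        simp only [gammaForm, ← Complex.coe_smul, map_smul, LinearMap.smul_apply, smul_eq_mul]
        ring)
      gammaForm_add_right
      (fun c u v => by
        simp only [gammaForm, ← Complex.coe_smul, map_smulₛₗ, Complex.conj_ofReal,
          RingHom.id_apply, smul_eq_mul]
        ring))

/-- The potential in the preferred chart at a point over `m`. -/
def localPotential (S : LagrangeanSplitting D) (ι : M → V) (m : M) (p : E × (E →L[ℂ] ℂ)) : ℝ :=
  let A := fderiv ℂ (localIncl E ι m) p.1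
  -- The real vector representing the covector is recovered by `localVector`; `ξ` is the image in
  -- `V` of the tangent vector with the same projection to `L`.
  let ξ := A (localLift S A (projL S (realIncl D (localVector D A (dualCoord E p.2)))))
  (gammaL D (localIncl E ι m p.1) (localIncl E ι m p.1) + gammaL D ξ ξ).re

/-- This replaces the pointwise choices in `sharp` and `rho` by operator inverses depending
analytically on the derivative of `ι`. -/
theorem potential_eq_localPotential (hM : IsLagrangeanPseudoKahler (E := E) D S ι)
    (x y : Cotangent E M) (hy : y.1 ∈ (chartAt E x.1).source) :
    potential S ι y = localPotential S ι x.1 (extChartAt (cotangentModel E) x y) := by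
  obtain ⟨m, σ⟩ := y
  obtain ⟨v, rfl⟩ := exists_eq_psi hM m σ
  have hA := isAdapted_fderiv_localIncl hM hy
  have h1 : localIncl E ι x.1 (extChartAt 𝓘(ℂ, E) x.1 m) = ι m :=
    congrArg ι ((extChartAt 𝓘(ℂ, E) x.1).left_inv (by rwa [extChartAt_source]))
  have h2 : realIncl D (localVector D (fderiv ℂ (localIncl E ι x.1) (extChartAt 𝓘(ℂ, E) x.1 m))
      (dualCoord E ((Complex.I • psi (E := E) ι D m v) ∘L chartFrame x.1 m))) = v := by
    obtain ⟨c, rfl⟩ := (realCoord D).surjective v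
    refine congrArg (realIncl D) (Eq.trans (congrArg (localVector D _) ?_)
      ((isInvertible_realPsiL hA).inverse_apply_self c))
    ext i
    change Complex.I * D.omega (realCoord D c) (dincl ι m (chartFrame x.1 m _)) = _
    rw [dincl_chartFrame hM hy]
    rfl
  rw [potential_eq hM, extChartAt_cotangent, localPotential]
  simp only
  rw [h1, h2, ← dincl_chartFrame hM hy]
  change _ = (gammaForm D (ι m) (ι m) + metric D ι m
    (chartFrame x.1 m (localLift S (fderiv ℂ (localIncl E ι x.1) (extChartAt 𝓘(ℂ, E) x.1 m))
      (S.proj v))) (chartFrame x.1 m (localLift S (fderiv ℂ (localIncl E ι x.1)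
        (extChartAt 𝓘(ℂ, E) x.1 m)) (S.proj v)))).re
  rw [chartFrame_localLift hM hy]

theorem contDiffAt_clm_apply_restrictScalars {F G X : Type*} [NormedAddCommGroup F]
    [NormedSpace ℂ F] [NormedAddCommGroup G] [NormedSpace ℂ G] [NormedAddCommGroup X]
    [NormedSpace ℝ X] {B : X → F →L[ℂ] G} {f : X → F} {x : X} (hB : ContDiffAt ℝ ω B x)
    (hf : ContDiffAt ℝ ω f x) : ContDiffAt ℝ ω (fun y => B y (f y)) x := by
  have h : ContDiff ℂ ω fun q : (F →L[ℂ] G) × F => q.1 q.2 := contDiff_fst.clm_apply contDiff_snd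
  exact (h.restrict_scalars ℝ).contDiffAt.comp x (hB.prodMk hf)

theorem contDiffAt_localPotential (hM : IsLagrangeanPseudoKahler (E := E) D S ι) {m y : M}
    (hy : y ∈ (chartAt E m).source) (w : E →L[ℂ] ℂ) :
    ContDiffAt ℝ ω (localPotential (E := E) S ι m) (extChartAt 𝓘(ℂ, E) m y, w) := by
  set p₀ : E × (E →L[ℂ] ℂ) := (extChartAt 𝓘(ℂ, E) m y, w)
  have hA₀ := isAdapted_fderiv_localIncl hM hy
  have hι : ContDiffAt ℝ ω (fun p : E × (E →L[ℂ] ℂ) => localIncl E ι m p.1) p₀ :=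
    ContDiffAt.comp (g := localIncl E ι m) p₀
      ((contDiffAt_localIncl hM hy).restrict_scalars ℝ) contDiffAt_fst
  have hA : ContDiffAt ℝ ω (fun p : E × (E →L[ℂ] ℂ) => fderiv ℂ (localIncl E ι m) p.1) p₀ :=
    ((contDiffAt_fderiv_localIncl hM hy).restrict_scalars ℝ).comp p₀ contDiffAt_fst
  have hw : ContDiffAt ℝ ω (fun p : E × (E →L[ℂ] ℂ) => dualCoord E p.2) p₀ :=
    ((LinearMap.toContinuousLinearMap (dualCoord E).toLinearMap).contDiff.restrict_scalars
      ℝ).contDiffAt.comp p₀ contDiffAt_snd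
  have hv : ContDiffAt ℝ ω (fun p : E × (E →L[ℂ] ℂ) =>
      localVector D (fderiv ℂ (localIncl E ι m) p.1) (dualCoord E p.2)) p₀ :=
    ContDiffAt.clm_apply (ContDiffAt.comp (g := localVector D) p₀ (contDiffAt_localVector hA₀) hA) hw
  have hv' : ContDiffAt ℝ ω (fun p : E × (E →L[ℂ] ℂ) =>
      projL S (realIncl D (localVector D (fderiv ℂ (localIncl E ι m) p.1) (dualCoord E p.2)))) p₀ :=
    ((projL S).contDiff.restrict_scalars ℝ).contDiffAt.comp p₀
      ((realIncl D).contDiff.contDiffAt.comp p₀ hv)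
  have hl : ContDiffAt ℝ ω (fun p : E × (E →L[ℂ] ℂ) =>
      localLift S (fderiv ℂ (localIncl E ι m) p.1)) p₀ :=
    ContDiffAt.comp (g := localLift S) p₀ ((contDiffAt_localLift hA₀).restrict_scalars ℝ) hA
  have hξ := contDiffAt_clm_apply_restrictScalars hA (contDiffAt_clm_apply_restrictScalars hl hv')
  have hγ : ∀ {f : E × (E →L[ℂ] ℂ) → V}, ContDiffAt ℝ ω f p₀ →
      ContDiffAt ℝ ω (fun p => gammaL D (f p) (f p)) p₀ := fun hf =>
    ((gammaL D).contDiff.contDiffAt.comp p₀ hf).clm_apply hf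
  exact Complex.reCLM.contDiff.contDiffAt.comp p₀ ((hγ hι).add (hγ hξ))

theorem contDiffAt_potential (hM : IsLagrangeanPseudoKahler (E := E) D S ι)
    (x : Cotangent E M) :
    ContDiffAt ℝ 2 (potential S ι ∘ (extChartAt (cotangentModel E) x).symm)
      (extChartAt (cotangentModel E) x x) := by
  have h := contDiffAt_localPotential hM (mem_chart_source E x.1) (x.2 ∘L chartFrame x.1 x.1)
  rw [← extChartAt_cotangent] at h
  refine (h.of_le (by simp)).congr_of_eventuallyEq ?_
  filter_upwards [eventually_extChartAt_symm (I := cotangentModel E)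
    (eventually_mem_chartAt_source x),
    eventually_extChartAt_right_inv (I := cotangentModel E) x] with z hz hz'
  rw [Function.comp_apply, potential_eq_localPotential hM x _ hz, hz']

end Potential

/-! ### Symplectic maps of `E × E^*`. -/

section Symplectic

variable {E : Type*} [NormedAddCommGroup E] [NormedSpace ℂ E]

/-- The standard symplectic form of `E × E^*`. -/
def localOmega (u v : E × (E →L[ℂ] ℂ)) : ℂ := v.2 u.1 - u.2 v.1

/-- Translation of the fibres by the differential of a holomorphic function is symplectic. -/
theorem localOmega_fderiv_translation {h : E → ℂ} {p : E × (E →L[ℂ] ℂ)}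
    (hh : ContDiffAt ℂ ω h p.1) (u v : E × (E →L[ℂ] ℂ)) :
    localOmega (fderiv ℂ (fun p : E × (E →L[ℂ] ℂ) => (p.1, p.2 + fderiv ℂ h p.1)) p u)
      (fderiv ℂ (fun p : E × (E →L[ℂ] ℂ) => (p.1, p.2 + fderiv ℂ h p.1)) p v) =
      localOmega u v := by
  have h1 : HasFDerivAt (fderiv ℂ h) (fderiv ℂ (fderiv ℂ h) p.1) p.1 :=
    ((hh.fderiv_right (m := ω) (by simp)).differentiableAt (by simp)).hasFDerivAt
  have h2 := (hasFDerivAt_fst (𝕜 := ℂ) (p := p)).prodMk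
    ((hasFDerivAt_snd (𝕜 := ℂ) (p := p)).add
      (HasFDerivAt.comp p h1 (hasFDerivAt_fst (𝕜 := ℂ) (p := p))))
  have h3 : HasFDerivAt (fun p : E × (E →L[ℂ] ℂ) => (p.1, p.2 + fderiv ℂ h p.1)) _ p := h2
  -- Symmetry of the second derivative, i.e. closedness of `dh`, cancels the extra terms.
  have hs : fderiv ℂ (fderiv ℂ h) p.1 u.1 v.1 = fderiv ℂ (fderiv ℂ h) p.1 v.1 u.1 :=
    hh.isSymmSndFDerivAt (by simp) u.1 v.1
  rw [h3.fderiv]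
  simp only [localOmega, ContinuousLinearMap.prod_apply, ContinuousLinearMap.comp_apply,
    ContinuousLinearMap.coe_fst', ContinuousLinearMap.coe_snd', add_apply, hs]
  ring

theorem contDiffAt_translation {h : E → ℂ} {p : E × (E →L[ℂ] ℂ)} (hh : ContDiffAt ℂ ω h p.1) :
    ContDiffAt ℂ ω (fun p : E × (E →L[ℂ] ℂ) => (p.1, p.2 + fderiv ℂ h p.1)) p :=
  contDiffAt_fst.prodMk
    (contDiffAt_snd.add (ContDiffAt.comp p (hh.fderiv_right (by simp)) contDiffAt_fst))

theorem contDiffAt_comp_inverse_fderiv [CompleteSpace E] {f : E → E} {p : E × (E →L[ℂ] ℂ)}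
    (hf : ContDiffAt ℂ ω f p.1) (hi : (fderiv ℂ f p.1).IsInvertible) :
    ContDiffAt ℂ ω (fun p : E × (E →L[ℂ] ℂ) => p.2 ∘L (fderiv ℂ f p.1).inverse) p := by
  have h1 : ContDiffAt ℂ ω (ContinuousLinearMap.inverse : (E →L[ℂ] E) → E →L[ℂ] E)
      (fderiv ℂ f p.1) := by
    obtain ⟨e, he⟩ := hi
    rw [← he]
    exact contDiffAt_map_inverse e
  have h2 : ContDiffAt ℂ ω (fun p : E × (E →L[ℂ] ℂ) => fderiv ℂ f p.1) p :=
    ContDiffAt.comp p (hf.fderiv_right (by simp)) contDiffAt_fst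
  exact contDiffAt_snd.clm_comp
    (ContDiffAt.comp (g := ContinuousLinearMap.inverse) p h1 h2)

theorem contDiffAt_cotangentLift [CompleteSpace E] {f : E → E} {p : E × (E →L[ℂ] ℂ)}
    (hf : ContDiffAt ℂ ω f p.1) (hi : (fderiv ℂ f p.1).IsInvertible) :
    ContDiffAt ℂ ω
      (fun p : E × (E →L[ℂ] ℂ) => (f p.1, p.2 ∘L (fderiv ℂ f p.1).inverse)) p :=
  (ContDiffAt.comp p hf contDiffAt_fst).prodMk (contDiffAt_comp_inverse_fderiv hf hi)

/-- Cotangent lifts are symplectic. -/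
theorem localOmega_fderiv_cotangentLift [CompleteSpace E] {f : E → E} {p : E × (E →L[ℂ] ℂ)}
    (hf : ContDiffAt ℂ ω f p.1) (hi : (fderiv ℂ f p.1).IsInvertible)
    (u v : E × (E →L[ℂ] ℂ)) :
    localOmega
      (fderiv ℂ (fun p : E × (E →L[ℂ] ℂ) => (f p.1, p.2 ∘L (fderiv ℂ f p.1).inverse)) p u)
      (fderiv ℂ (fun p : E × (E →L[ℂ] ℂ) => (f p.1, p.2 ∘L (fderiv ℂ f p.1).inverse)) p v) =
      localOmega u v := by
  set Q : E × (E →L[ℂ] ℂ) → E →L[ℂ] ℂ := fun p => p.2 ∘L (fderiv ℂ f p.1).inverse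
  have hQ : HasFDerivAt Q (fderiv ℂ Q p) p :=
    ((contDiffAt_comp_inverse_fderiv hf hi).differentiableAt (by simp)).hasFDerivAt
  have hf1 : HasFDerivAt (fun p : E × (E →L[ℂ] ℂ) => f p.1)
      (fderiv ℂ f p.1 ∘L ContinuousLinearMap.fst ℂ E (E →L[ℂ] ℂ)) p :=
    (hf.differentiableAt (by simp)).hasFDerivAt.comp p hasFDerivAt_fst
  have hf2 : HasFDerivAt (fun p : E × (E →L[ℂ] ℂ) => fderiv ℂ f p.1)
      (fderiv ℂ (fderiv ℂ f) p.1 ∘L ContinuousLinearMap.fst ℂ E (E →L[ℂ] ℂ)) p :=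
    ((hf.fderiv_right (m := ω) (by simp)).differentiableAt (by simp)).hasFDerivAt.comp p
      hasFDerivAt_fst
  have hev : ∀ᶠ q in 𝓝 p, (fderiv ℂ f q.1).IsInvertible := by
    obtain ⟨e, he⟩ := hi
    have h : ∀ᶠ A in 𝓝 (fderiv ℂ f p.1), A.IsInvertible := by
      rw [← he]
      exact e.nhds
    exact hf2.continuousAt.eventually h
  -- Differentiating this identity avoids a formula for the derivative of the inverse;
  -- antisymmetrizing the result removes the second derivative of `f`.
  have hQf : (fun q : E × (E →L[ℂ] ℂ) => Q q ∘L fderiv ℂ f q.1) =ᶠ[𝓝 p] fun q => q.2 := by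
    filter_upwards [hev] with q hq
    rw [ContinuousLinearMap.comp_assoc, hq.inverse_comp_self, ContinuousLinearMap.comp_id]
  have key : ∀ a b : E × (E →L[ℂ] ℂ),
      Q p (fderiv ℂ (fderiv ℂ f) p.1 a.1 b.1) + fderiv ℂ Q p a (fderiv ℂ f p.1 b.1) =
        a.2 b.1 := by
    intro a b
    have h1 := (hQ.clm_comp hf2).congr_of_eventuallyEq hQf.symm
    have h2 := congrArg (fun B : (E × (E →L[ℂ] ℂ)) →L[ℂ] (E →L[ℂ] ℂ) => B a b.1)
      (h1.unique hasFDerivAt_snd)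
    simpa using h2
  have hs : fderiv ℂ (fderiv ℂ f) p.1 u.1 v.1 = fderiv ℂ (fderiv ℂ f) p.1 v.1 u.1 :=
    hf.isSymmSndFDerivAt (by simp) u.1 v.1
  have hd : fderiv ℂ (fun p : E × (E →L[ℂ] ℂ) => (f p.1, Q p)) p = _ := (hf1.prodMk hQ).fderiv
  have h1 := key u v
  have h2 := key v u
  rw [hs] at h1
  rw [hd]
  simp only [localOmega, ContinuousLinearMap.prod_apply, ContinuousLinearMap.comp_apply,
    ContinuousLinearMap.coe_fst']
  linear_combination h2 - h1

end Symplectic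

/-! ### Translations by `V^τ`. -/

section Automorphisms

variable {V : Type*} [NormedAddCommGroup V] [NormedSpace ℂ V] [FiniteDimensional ℂ V]
  {D : FundamentalData V} {S : LagrangeanSplitting D}
  {E : Type*} [NormedAddCommGroup E] [NormedSpace ℂ E] [FiniteDimensional ℂ E]
  {M : Type*} [TopologicalSpace M] [ChartedSpace E M] [IsManifold 𝓘(ℂ, E) ω M]
  {ι : M → V}

/-- The action of `v ∈ V^τ` on `T^*M`. -/
def translate (E : Type*) [NormedAddCommGroup E] [NormedSpace ℂ E] [ChartedSpace E M]
    [IsManifold 𝓘(ℂ, E) ω M] (D : FundamentalData V) (ι : M → V) (v : realPoints D) :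
    Equiv.Perm (Cotangent E M) where
  toFun x := ⟨x.1, x.2 + Complex.I • psi ι D x.1 v⟩
  invFun x := ⟨x.1, x.2 - Complex.I • psi ι D x.1 v⟩
  left_inv x := by simp
  right_inv x := by simp

omit [FiniteDimensional ℂ E] in
theorem translate_apply (v : realPoints D) (x : Cotangent E M) :
    translate E D ι v x = ⟨x.1, x.2 + Complex.I • psi ι D x.1 v⟩ := rfl

omit [FiniteDimensional ℂ E] in
theorem translate_add (v w : realPoints D) :
    translate E D ι (v + w) = translate E D ι v * translate E D ι w := by
  ext x : 1
  have h : ∀ σ : TangentSpace 𝓘(ℂ, E) x.1 →L[ℂ] ℂ,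
      σ + Complex.I • psi ι D x.1 (v + w : realPoints D) =
        σ + Complex.I • psi ι D x.1 w + Complex.I • psi ι D x.1 v := by
    intro σ
    ext u
    simp [psi]
    ring
  exact congrArg (TotalSpace.mk x.1) (h x.2)

omit [FiniteDimensional ℂ E] in
theorem translate_zero : translate E D ι (0 : realPoints D) = 1 := by
  ext x : 1
  refine congrArg (TotalSpace.mk x.1) ?_
  ext u
  simp [psi]

omit [FiniteDimensional ℂ E] in
theorem translate_symm (v : realPoints D) :
    (translate E D ι v).symm = translate E D ι (-v) := by
  change (translate E D ι v)⁻¹ = _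
  rw [inv_eq_iff_mul_eq_one, ← translate_add, add_neg_cancel, translate_zero]

/-- The holomorphic function on `M`, in a preferred chart, whose differential is `√-1 ψ(v)`. -/
def localHamiltonian (E : Type*) [NormedAddCommGroup E] [NormedSpace ℂ E] [ChartedSpace E M]
    (D : FundamentalData V) (ι : M → V) (v : V) (m : M) (z : E) : ℂ :=
  Complex.I * D.omega v (localIncl E ι m z)

omit [FiniteDimensional ℂ E] [IsManifold 𝓘(ℂ, E) ω M] in
theorem hasFDerivAt_localHamiltonian (v : V) {m : M} {z : E}
    (hz : DifferentiableAt ℂ (localIncl E ι m) z) :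
    HasFDerivAt (localHamiltonian E D ι v m)
      (Complex.I • (LinearMap.toContinuousLinearMap (D.omega v) ∘L
        fderiv ℂ (localIncl E ι m) z)) z :=
  ((LinearMap.toContinuousLinearMap (D.omega v)).hasFDerivAt.comp z hz.hasFDerivAt).const_mul
    Complex.I

omit [FiniteDimensional ℂ E] in
theorem contDiffAt_localHamiltonian (hM : IsLagrangeanPseudoKahler (E := E) D S ι) (v : V)
    {m y : M} (hy : y ∈ (chartAt E m).source) :
    ContDiffAt ℂ ω (localHamiltonian E D ι v m) (extChartAt 𝓘(ℂ, E) m y) :=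
  contDiffAt_const.mul ((LinearMap.toContinuousLinearMap (D.omega v)).contDiff.contDiffAt.comp _
    (contDiffAt_localIncl hM hy))

omit [FiniteDimensional ℂ E] in
-- Exactness of `√-1 ψ(v)`: in a chart, translation by `v` adds the differential of a holomorphic
-- function, hence is symplectic.
theorem psi_comp_chartFrame (hM : IsLagrangeanPseudoKahler (E := E) D S ι) (v : V) {m y : M}
    (hy : y ∈ (chartAt E m).source) :
    (Complex.I • psi (E := E) ι D y v) ∘L chartFrame m y =
      fderiv ℂ (localHamiltonian E D ι v m) (extChartAt 𝓘(ℂ, E) m y) := by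
  rw [(hasFDerivAt_localHamiltonian v
    ((contDiffAt_localIncl hM hy).differentiableAt (by simp))).fderiv]
  ext u
  change Complex.I * D.omega v (dincl ι y (chartFrame m y u)) = _
  rw [dincl_chartFrame hM hy]
  rfl

omit [FiniteDimensional ℂ E] in
theorem translate_local (hM : IsLagrangeanPseudoKahler (E := E) D S ι) (v : realPoints D)
    (x : Cotangent E M) :
    ContMDiffAt (cotangentModel E) (cotangentModel E) ω (translate E D ι v) x ∧
      mfderiv (cotangentModel E) (cotangentModel E) (translate E D ι v) x =
        fderiv ℂ (fun p : E × (E →L[ℂ] ℂ) =>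
          (p.1, p.2 + fderiv ℂ (localHamiltonian E D ι v x.1) p.1))
          (extChartAt (cotangentModel E) x x) := by
  refine contMDiffAt_and_mfderiv_of_eventually ?_ ?_
  · filter_upwards [eventually_mem_chartAt_source x] with y hy
    refine ⟨(mem_extChartAt_cotangent_source _ _).2 hy, ?_⟩
    rw [extChartAt_cotangent, extChartAt_cotangent]
    refine Prod.ext rfl ?_
    rw [← psi_comp_chartFrame hM v hy]
    rfl
  · rw [extChartAt_cotangent]
    exact contDiffAt_translation (p := (_, _))
      (contDiffAt_localHamiltonian hM v (mem_chart_source E x.1))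

theorem isPluriharmonic_translate (hM : IsLagrangeanPseudoKahler (E := E) D S ι)
    (v : realPoints D) : IsPluriharmonic (cotangentModel E) (fun x : Cotangent E M =>
      potential S ι (translate E D ι v x) - potential S ι x) := by
  -- The witness is the increment from `potential_add_sub` in cotangent coordinates; it is
  -- holomorphic since `localLift` is holomorphic in the derivative of `ι`.
  refine isPluriharmonic_of_eventually fun x => ⟨fun p =>
    -4 * p.2 (localLift S (fderiv ℂ (localIncl E ι x.1) p.1) (S.proj v)) -
      2 * fderiv ℂ (localHamiltonian E D ι v x.1) p.1
        (localLift S (fderiv ℂ (localIncl E ι x.1) p.1) (S.proj v)), ?_, ?_⟩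
  · rw [extChartAt_cotangent]
    have hx := mem_chart_source E x.1
    set p₀ : E × (E →L[ℂ] ℂ) := (extChartAt 𝓘(ℂ, E) x.1 x.1, x.2 ∘L chartFrame x.1 x.1)
    have hA : ContDiffAt ℂ ω
        (fun p : E × (E →L[ℂ] ℂ) => fderiv ℂ (localIncl E ι x.1) p.1) p₀ :=
      ContDiffAt.comp p₀ (contDiffAt_fderiv_localIncl hM hx) contDiffAt_fst
    have hl : ContDiffAt ℂ ω (fun p : E × (E →L[ℂ] ℂ) =>
        localLift S (fderiv ℂ (localIncl E ι x.1) p.1) (S.proj v)) p₀ :=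
      (ContDiffAt.comp (g := localLift S) p₀
        (contDiffAt_localLift (isAdapted_fderiv_localIncl hM hx)) hA).clm_apply contDiffAt_const
    have hh : ContDiffAt ℂ ω (fun p : E × (E →L[ℂ] ℂ) =>
        fderiv ℂ (localHamiltonian E D ι v x.1) p.1) p₀ :=
      ContDiffAt.comp p₀ ((contDiffAt_localHamiltonian hM v hx).fderiv_right (by simp))
        contDiffAt_fst
    exact (contDiffAt_const.mul (contDiffAt_snd.clm_apply hl)).sub
      (contDiffAt_const.mul (hh.clm_apply hl))
  · filter_upwards [eventually_mem_chartAt_source x] with y hy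
    refine (potential_add_sub hM y.1 y.2 v).trans ?_
    rw [extChartAt_cotangent, ← psi_comp_chartFrame hM v hy, ← chartFrame_localLift hM hy]
    rfl

theorem isHyperKahlerAutomorphism_of_isPluriharmonic
    (hM : IsLagrangeanPseudoKahler (E := E) D S ι) {Φ : Equiv.Perm (Cotangent E M)}
    (h1 : ContMDiff (cotangentModel E) (cotangentModel E) ω Φ)
    (h2 : ContMDiff (cotangentModel E) (cotangentModel E) ω Φ.symm)
    (h3 : IsPluriharmonic (cotangentModel E) (fun x => potential S ι (Φ x) - potential S ι x))
    (h4 : ∀ (x : Cotangent E M) (u v : TangentSpace (cotangentModel E) x),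
      Omega (Φ x) (mfderiv (cotangentModel E) (cotangentModel E) Φ x u)
        (mfderiv (cotangentModel E) (cotangentModel E) Φ x v) = Omega x u v) :
    IsHyperKahlerAutomorphism S ι Φ :=
  ⟨h1, h2, leviForm_eq_of_isPluriharmonic (contDiffAt_potential hM) h1 h3, h4⟩

theorem isHyperKahlerAutomorphism_translate (hM : IsLagrangeanPseudoKahler (E := E) D S ι)
    (v : realPoints D) : IsHyperKahlerAutomorphism S ι (translate E D ι v) := by
  refine isHyperKahlerAutomorphism_of_isPluriharmonic hM (fun x => (translate_local hM v x).1) ?_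
    (isPluriharmonic_translate hM v) fun x u w => ?_
  · rw [translate_symm]
    exact fun x => (translate_local hM (-v) x).1
  · rw [(translate_local hM v x).2]
    refine localOmega_fderiv_translation ?_ u w
    rw [extChartAt_cotangent]
    exact contDiffAt_localHamiltonian hM v (mem_chart_source E x.1)

omit [FiniteDimensional ℂ V] in
theorem IsHyperKahlerAutomorphism.mul {Φ Ψ : Equiv.Perm (Cotangent E M)}
    (hΦ : IsHyperKahlerAutomorphism S ι Φ) (hΨ : IsHyperKahlerAutomorphism S ι Ψ) :
    IsHyperKahlerAutomorphism S ι (Φ * Ψ) := by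
  have hd : ∀ x, mfderiv (cotangentModel E) (cotangentModel E) (Φ * Ψ) x =
      mfderiv (cotangentModel E) (cotangentModel E) Φ (Ψ x) ∘L
        mfderiv (cotangentModel E) (cotangentModel E) Ψ x := fun x =>
    mfderiv_comp x ((hΦ.holomorphic _).mdifferentiableAt (by simp))
      ((hΨ.holomorphic _).mdifferentiableAt (by simp))
  refine ⟨hΦ.holomorphic.comp hΨ.holomorphic, hΨ.holomorphic_symm.comp hΦ.holomorphic_symm,
    fun x u v => ?_, fun x u v => ?_⟩
  · rw [hd]
    exact (hΦ.isometry (Ψ x) _ _).trans (hΨ.isometry x u v)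
  · rw [hd]
    exact (hΦ.symplectic (Ψ x) _ _).trans (hΨ.symplectic x u v)

end Automorphisms

/-! ### Point transformations induced by `Aut_sd(M)`. -/

section Duality

variable {V : Type*} [NormedAddCommGroup V] [NormedSpace ℂ V] [FiniteDimensional ℂ V]
  {D : FundamentalData V} {S : LagrangeanSplitting D}
  {E : Type*} [NormedAddCommGroup E] [NormedSpace ℂ E]
  {M : Type*} [TopologicalSpace M] [ChartedSpace E M]
  {ι : M → V}

/-- The map `M → M` induced by an element of `Aut_sd(M)`. -/
def autFun (φ : autSd S ι) (m : M) : M := ((φ.2.2.2.1 (ι m)).1 ⟨m, rfl⟩).choose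

omit [FiniteDimensional ℂ V] [TopologicalSpace M] in
theorem incl_autFun (φ : autSd S ι) (m : M) : ι (autFun φ m) = (φ : V ≃ₗ[ℂ] V) (ι m) :=
  ((φ.2.2.2.1 (ι m)).1 ⟨m, rfl⟩).choose_spec

omit [FiniteDimensional ℂ V] in
theorem autFun_mul (hM : IsLagrangeanPseudoKahler (E := E) D S ι) (φ χ : autSd S ι) (m : M) :
    autFun (φ * χ) m = autFun φ (autFun χ m) := by
  apply hM.embedding.isEmbedding.injective
  simp only [incl_autFun]
  rfl

omit [FiniteDimensional ℂ V] in
theorem autFun_one (hM : IsLagrangeanPseudoKahler (E := E) D S ι) (m : M) :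
    autFun (1 : autSd S ι) m = m := by
  apply hM.embedding.isEmbedding.injective
  exact incl_autFun 1 m

/-- The composite `ι ∘ f = φ ∘ ι` is holomorphic, and holomorphy can be tested after an embedding
which is an immersion. -/
theorem contMDiff_autFun (hM : IsLagrangeanPseudoKahler (E := E) D S ι) (φ : autSd S ι) :
    ContMDiff 𝓘(ℂ, E) 𝓘(ℂ, E) ω (autFun φ) := by
  have h : ι ∘ autFun φ =
      LinearMap.toContinuousLinearMap (φ : V ≃ₗ[ℂ] V).toLinearMap ∘ ι :=
    funext (incl_autFun φ)
  have hs : ContMDiff 𝓘(ℂ, E) 𝓘(ℂ, V) ω (ι ∘ autFun φ) := by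
    rw [h]
    exact (ContinuousLinearMap.contMDiff _).comp hM.contMDiff
  rw [ContMDiff.iff_comp_isImmersion hM.embedding.isImmersion]
  exact ⟨hM.embedding.isEmbedding.continuous_iff.2 hs.continuous, hs⟩

/-- The biholomorphic map `M → M` induced by an element of `Aut_sd(M)`. -/
def autDiffeo (hM : IsLagrangeanPseudoKahler (E := E) D S ι) (φ : autSd S ι) :
    Diffeomorph 𝓘(ℂ, E) 𝓘(ℂ, E) M M ω where
  toFun := autFun φ
  invFun := autFun φ⁻¹
  left_inv m := by rw [← autFun_mul hM, inv_mul_cancel, autFun_one hM]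
  right_inv m := by rw [← autFun_mul hM, mul_inv_cancel, autFun_one hM]
  contMDiff_toFun := contMDiff_autFun hM φ
  contMDiff_invFun := contMDiff_autFun hM φ⁻¹

theorem autDiffeo_mul (hM : IsLagrangeanPseudoKahler (E := E) D S ι) (φ χ : autSd S ι) :
    autDiffeo hM (φ * χ) = (autDiffeo hM χ).trans (autDiffeo hM φ) :=
  Diffeomorph.ext fun m => autFun_mul hM φ χ m

theorem autDiffeo_one (hM : IsLagrangeanPseudoKahler (E := E) D S ι) :
    autDiffeo hM (1 : autSd S ι) = Diffeomorph.refl _ M ω :=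
  Diffeomorph.ext fun m => autFun_one hM m

section PointTransformation

theorem isInvertible_mfderiv (f : Diffeomorph 𝓘(ℂ, E) 𝓘(ℂ, E) M M ω) (m : M) :
    (mfderiv 𝓘(ℂ, E) 𝓘(ℂ, E) f m).IsInvertible :=
  ⟨f.mfderivToContinuousLinearEquiv (by simp) m, rfl⟩

variable [IsManifold 𝓘(ℂ, E) ω M]

omit [IsManifold 𝓘(ℂ, E) ω M] in
theorem pointTransformation_trans (f g : Diffeomorph 𝓘(ℂ, E) 𝓘(ℂ, E) M M ω)
    (x : Cotangent E M) :
    pointTransformation (f.trans g) x = pointTransformation g (pointTransformation f x) := by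
  have h : (mfderiv 𝓘(ℂ, E) 𝓘(ℂ, E) (f.trans g) x.1 :
        TangentSpace 𝓘(ℂ, E) x.1 →L[ℂ] TangentSpace 𝓘(ℂ, E) (g (f x.1))) =
      mfderiv 𝓘(ℂ, E) 𝓘(ℂ, E) g (f x.1) ∘L mfderiv 𝓘(ℂ, E) 𝓘(ℂ, E) f x.1 :=
    mfderiv_comp x.1 (g.mdifferentiable (by simp) _) (f.mdifferentiable (by simp) _)
  have h' := (congrArg ContinuousLinearMap.inverse h).trans
    ((isInvertible_mfderiv g (f x.1)).inverse_comp_of_left)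
  exact congrArg (fun B : TangentSpace 𝓘(ℂ, E) (g (f x.1)) →L[ℂ] TangentSpace 𝓘(ℂ, E) x.1 =>
    (⟨g (f x.1), x.2 ∘L B⟩ : Cotangent E M)) h'

omit [IsManifold 𝓘(ℂ, E) ω M] in
theorem pointTransformation_refl (x : Cotangent E M) :
    pointTransformation (Diffeomorph.refl 𝓘(ℂ, E) M ω) x = x := by
  have h : (mfderiv 𝓘(ℂ, E) 𝓘(ℂ, E) (Diffeomorph.refl 𝓘(ℂ, E) M ω) x.1 :
        TangentSpace 𝓘(ℂ, E) x.1 →L[ℂ] TangentSpace 𝓘(ℂ, E) x.1) =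
      ContinuousLinearMap.id ℂ (TangentSpace 𝓘(ℂ, E) x.1) := mfderiv_id
  have h' := (congrArg ContinuousLinearMap.inverse h).trans ContinuousLinearMap.inverse_id
  exact congrArg (fun B : TangentSpace 𝓘(ℂ, E) x.1 →L[ℂ] TangentSpace 𝓘(ℂ, E) x.1 =>
    (⟨x.1, x.2 ∘L B⟩ : Cotangent E M)) h'

/-- A biholomorphic map in preferred charts. -/
def localDiffeo (f : Diffeomorph 𝓘(ℂ, E) 𝓘(ℂ, E) M M ω) (m : M) : E → E :=
  extChartAt 𝓘(ℂ, E) (f m) ∘ f ∘ (extChartAt 𝓘(ℂ, E) m).symm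

theorem mfderiv_comp_chartFrame (f : Diffeomorph 𝓘(ℂ, E) 𝓘(ℂ, E) M M ω) {m y : M}
    (hy : y ∈ (chartAt E m).source) (hy' : f y ∈ (chartAt E (f m)).source) :
    mfderiv 𝓘(ℂ, E) 𝓘(ℂ, E) f y ∘L chartFrame m y =
      chartFrame (f m) (f y) ∘L fderiv ℂ (localDiffeo f m) (extChartAt 𝓘(ℂ, E) m y) :=
  ContinuousLinearMap.ext fun u =>
    mfderiv_chartFrame_eq_chartFrame hy hy' (f.mdifferentiable (by simp) y) u

theorem isInvertible_chartFrame {m y : M} (hy : y ∈ (chartAt E m).source) :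
    (chartFrame (E := E) m y).IsInvertible :=
  .of_inverse (g := chartCoframe m y)
    (ContinuousLinearMap.ext fun u => chartFrame_chartCoframe hy u)
    (ContinuousLinearMap.ext fun u => chartCoframe_chartFrame hy u)

theorem isInvertible_fderiv_localDiffeo (f : Diffeomorph 𝓘(ℂ, E) 𝓘(ℂ, E) M M ω) {m y : M}
    (hy : y ∈ (chartAt E m).source) (hy' : f y ∈ (chartAt E (f m)).source) :
    (fderiv ℂ (localDiffeo f m) (extChartAt 𝓘(ℂ, E) m y)).IsInvertible := by
  have h := (isInvertible_mfderiv f y).comp (isInvertible_chartFrame (E := E) hy)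
  rw [mfderiv_comp_chartFrame f hy hy'] at h
  obtain ⟨e, he⟩ := isInvertible_chartFrame (E := E) hy'
  rw [← he] at h
  exact ContinuousLinearMap.isInvertible_equiv_comp.1 h

theorem inverse_mfderiv_comp_chartFrame (f : Diffeomorph 𝓘(ℂ, E) 𝓘(ℂ, E) M M ω) {m y : M}
    (hy : y ∈ (chartAt E m).source) (hy' : f y ∈ (chartAt E (f m)).source) :
    (mfderiv 𝓘(ℂ, E) 𝓘(ℂ, E) f y).inverse ∘L chartFrame (f m) (f y) = chartFrame m y ∘L
      (fderiv ℂ (localDiffeo f m) (extChartAt 𝓘(ℂ, E) m y)).inverse := by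
  ext u
  -- On vectors of the form `df w` both inverses cancel, reducing the claim to
  -- `mfderiv_comp_chartFrame`.
  obtain ⟨w, rfl⟩ : ∃ w, fderiv ℂ (localDiffeo f m) (extChartAt 𝓘(ℂ, E) m y) w = u :=
    ⟨_, (isInvertible_fderiv_localDiffeo f hy hy').self_apply_inverse u⟩
  have h := DFunLike.congr_fun (mfderiv_comp_chartFrame f hy hy') w
  simp only [ContinuousLinearMap.comp_apply] at h ⊢
  rw [← h, (isInvertible_mfderiv f y).inverse_apply_self,
    (isInvertible_fderiv_localDiffeo f hy hy').inverse_apply_self]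

variable [FiniteDimensional ℂ E]

theorem pointTransformation_local (f : Diffeomorph 𝓘(ℂ, E) 𝓘(ℂ, E) M M ω) (x : Cotangent E M) :
    (ContMDiffAt (cotangentModel E) (cotangentModel E) ω (pointTransformation f) x ∧
      mfderiv (cotangentModel E) (cotangentModel E) (pointTransformation f) x =
        fderiv ℂ (fun p : E × (E →L[ℂ] ℂ) =>
          (localDiffeo f x.1 p.1, p.2 ∘L (fderiv ℂ (localDiffeo f x.1) p.1).inverse))
          (extChartAt (cotangentModel E) x x)) ∧
      ContDiffAt ℂ ω (localDiffeo f x.1) (extChartAt (cotangentModel E) x x).1 ∧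
      (fderiv ℂ (localDiffeo f x.1) (extChartAt (cotangentModel E) x x).1).IsInvertible := by
  have : CompleteSpace E := FiniteDimensional.complete ℂ E
  have hf : ContDiffAt ℂ ω (localDiffeo f x.1) (extChartAt (cotangentModel E) x x).1 := by
    have h := (contMDiffAt_iff.1 (f.contMDiff x.1)).2
    rw [modelWithCornersSelf_coe, Set.range_id, contDiffWithinAt_univ] at h
    rwa [extChartAt_cotangent]
  have hi : (fderiv ℂ (localDiffeo f x.1) (extChartAt (cotangentModel E) x x).1).IsInvertible := by
    rw [extChartAt_cotangent]
    exact isInvertible_fderiv_localDiffeo f (mem_chart_source E x.1) (mem_chart_source E (f x.1))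
  refine ⟨contMDiffAt_and_mfderiv_of_eventually ?_ (contDiffAt_cotangentLift hf hi), hf, hi⟩
  have hc : ∀ᶠ y in 𝓝 x, f y.1 ∈ (chartAt E (f x.1)).source :=
    (f.continuous.comp (FiberBundle.continuous_proj (E →L[ℂ] ℂ) _)).continuousAt.eventually
      (chart_source_mem_nhds E (f x.1))
  filter_upwards [eventually_mem_chartAt_source x, hc] with y hy hy'
  refine ⟨(mem_extChartAt_cotangent_source _ _).2 hy', ?_⟩
  rw [extChartAt_cotangent, extChartAt_cotangent]
  refine Prod.ext ?_ ?_
  · change extChartAt 𝓘(ℂ, E) (f x.1) (f y.1) = extChartAt 𝓘(ℂ, E) (f x.1)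
      (f ((extChartAt 𝓘(ℂ, E) x.1).symm (extChartAt 𝓘(ℂ, E) x.1 y.1)))
    rw [(extChartAt 𝓘(ℂ, E) x.1).left_inv (by rwa [extChartAt_source])]
  · exact congrArg (fun B : E →L[ℂ] TangentSpace 𝓘(ℂ, E) y.1 => y.2 ∘L B)
      (inverse_mfderiv_comp_chartFrame f hy hy')

theorem contMDiff_pointTransformation (f : Diffeomorph 𝓘(ℂ, E) 𝓘(ℂ, E) M M ω) :
    ContMDiff (cotangentModel E) (cotangentModel E) ω
      (pointTransformation f : Cotangent E M → Cotangent E M) :=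
  fun x => (pointTransformation_local f x).1.1

theorem Omega_pointTransformation (f : Diffeomorph 𝓘(ℂ, E) 𝓘(ℂ, E) M M ω) (x : Cotangent E M)
    (u v : TangentSpace (cotangentModel E) x) :
    Omega (pointTransformation f x)
      (mfderiv (cotangentModel E) (cotangentModel E) (pointTransformation f) x u)
      (mfderiv (cotangentModel E) (cotangentModel E) (pointTransformation f) x v) =
      Omega x u v := by
  have : CompleteSpace E := FiniteDimensional.complete ℂ E
  obtain ⟨⟨-, h⟩, hf, hi⟩ := pointTransformation_local f x
  rw [h]
  exact localOmega_fderiv_cotangentLift hf hi u v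

end PointTransformation

variable [FiniteDimensional ℂ E]

omit [FiniteDimensional ℂ V] [TopologicalSpace M] in
theorem gammaForm_autSd (φ : autSd S ι) (u v : V) :
    gammaForm D ((φ : V ≃ₗ[ℂ] V) u) ((φ : V ≃ₗ[ℂ] V) v) = gammaForm D u v := by
  rw [gammaForm, ← φ.2.2.1 v, φ.2.1, gammaForm]

omit [FiniteDimensional ℂ E] in
theorem dincl_mfderiv_autDiffeo (hM : IsLagrangeanPseudoKahler (E := E) D S ι) (φ : autSd S ι)
    (m : M) (u : TangentSpace 𝓘(ℂ, E) m) :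
    dincl ι (autDiffeo hM φ m) (mfderiv 𝓘(ℂ, E) 𝓘(ℂ, E) (autDiffeo hM φ) m u) =
      (φ : V ≃ₗ[ℂ] V) (dincl ι m u) := by
  have h : ι ∘ autDiffeo hM φ =
      LinearMap.toContinuousLinearMap (φ : V ≃ₗ[ℂ] V).toLinearMap ∘ ι :=
    funext (incl_autFun φ)
  have h1 := mfderiv_comp m (hM.mdifferentiableAt (autDiffeo hM φ m))
    ((autDiffeo hM φ).mdifferentiable (by simp) m)
  have h2 := mfderiv_comp m (g := LinearMap.toContinuousLinearMap (φ : V ≃ₗ[ℂ] V).toLinearMap)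
    (ContinuousLinearMap.mdifferentiableAt _) (hM.mdifferentiableAt m)
  rw [ContinuousLinearMap.mfderiv_eq] at h2
  have h3 : ∀ g g' : M → V, g = g' → (mfderiv 𝓘(ℂ, E) 𝓘(ℂ, V) g m : E →L[ℂ] V) u =
      (mfderiv 𝓘(ℂ, E) 𝓘(ℂ, V) g' m : E →L[ℂ] V) u := by
    rintro _ _ rfl
    rfl
  exact (DFunLike.congr_fun h1 u).symm.trans ((h3 _ _ h).trans (DFunLike.congr_fun h2 u))

/-- The action of `Aut_sd(M)` on `V^τ`. -/
def autVector (φ : autSd S ι) (v : realPoints D) : realPoints D :=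
  ⟨(φ : V ≃ₗ[ℂ] V) v, autSd_tau φ v.2⟩

omit [FiniteDimensional ℂ E] in
-- Invariance of `ω` under `φ`, together with `dι ∘ df = φ ∘ dι`. This is the equivariance behind
-- the semidirect product.
theorem psi_comp_inverse (hM : IsLagrangeanPseudoKahler (E := E) D S ι) (φ : autSd S ι)
    (v : realPoints D) (m : M) :
    psi (E := E) ι D m v ∘L (mfderiv 𝓘(ℂ, E) 𝓘(ℂ, E) (autDiffeo hM φ) m).inverse =
      psi ι D (autDiffeo hM φ m) (autVector φ v) := by
  ext u
  have hi := isInvertible_mfderiv (autDiffeo hM φ) m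
  obtain ⟨w, rfl⟩ : ∃ w, mfderiv 𝓘(ℂ, E) 𝓘(ℂ, E) (autDiffeo hM φ) m w = u :=
    ⟨_, hi.self_apply_inverse u⟩
  refine (congrArg (fun t => D.omega v (dincl ι m t)) (hi.inverse_apply_self w)).trans ?_
  change _ = D.omega ((φ : V ≃ₗ[ℂ] V) v) (dincl ι (autDiffeo hM φ m) _)
  rw [dincl_mfderiv_autDiffeo, φ.2.1]

/-- Since `φ` preserves `L'`, vectors with equal projections to `L` have images with equal
projections. -/
theorem lift_autDiffeo (hM : IsLagrangeanPseudoKahler (E := E) D S ι) (φ : autSd S ι)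
    (v : realPoints D) (m : M) :
    lift S ι (autDiffeo hM φ m) (S.proj (autVector φ v)) =
      mfderiv 𝓘(ℂ, E) 𝓘(ℂ, E) (autDiffeo hM φ) m (lift S ι m (S.proj v)) := by
  apply (hM.isAdapted (autDiffeo hM φ m)).bijective.1
  refine (proj_dincl_lift hM _ _).trans ?_
  change S.proj ((φ : V ≃ₗ[ℂ] V) v) = S.proj (dincl ι (autDiffeo hM φ m) _)
  rw [dincl_mfderiv_autDiffeo, proj_eq_iff, ← map_sub, ← φ.2.2.2.2.2, ← proj_eq_iff,
    proj_dincl_lift hM]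

omit [FiniteDimensional ℂ E] in
theorem pointTransformation_autDiffeo_translate (hM : IsLagrangeanPseudoKahler (E := E) D S ι)
    [IsManifold 𝓘(ℂ, E) ω M] (φ : autSd S ι) (v : realPoints D) (x : Cotangent E M) :
    pointTransformation (autDiffeo hM φ) (translate E D ι v x) =
      translate E D ι (autVector φ v) (pointTransformation (autDiffeo hM φ) x) := by
  refine congrArg (TotalSpace.mk (autDiffeo hM φ x.1)) ?_
  have h : ∀ σ : TangentSpace 𝓘(ℂ, E) x.1 →L[ℂ] ℂ,
      (σ + Complex.I • psi ι D x.1 v) ∘L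
        (mfderiv 𝓘(ℂ, E) 𝓘(ℂ, E) (autDiffeo hM φ) x.1).inverse =
      σ ∘L (mfderiv 𝓘(ℂ, E) 𝓘(ℂ, E) (autDiffeo hM φ) x.1).inverse +
        Complex.I • psi ι D (autDiffeo hM φ x.1) (autVector φ v) := fun σ => by
    rw [← psi_comp_inverse hM φ v x.1]
    rfl
  exact h x.2

/-- Writing the covector as `√-1 ψ_m(v)` turns the claim into invariance of `γ`, since all data in
`potential_eq` are moved by `φ`. -/
theorem potential_pointTransformation (hM : IsLagrangeanPseudoKahler (E := E) D S ι)
    [IsManifold 𝓘(ℂ, E) ω M] (φ : autSd S ι) (x : Cotangent E M) :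
    potential S ι (pointTransformation (autDiffeo hM φ) x) = potential S ι x := by
  obtain ⟨m, σ⟩ := x
  obtain ⟨v, rfl⟩ := exists_eq_psi hM m σ
  have h : pointTransformation (autDiffeo hM φ) ⟨m, Complex.I • psi (E := E) ι D m v⟩ =
      (⟨autDiffeo hM φ m, Complex.I • psi ι D (autDiffeo hM φ m) (autVector φ v)⟩ :
        Cotangent E M) := by
    rw [← psi_comp_inverse hM φ v m]
    rfl
  rw [h, potential_eq hM, potential_eq hM, lift_autDiffeo]
  simp only [metric, dincl_mfderiv_autDiffeo, gammaForm_autSd]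
  rw [show ι (autDiffeo hM φ m) = (φ : V ≃ₗ[ℂ] V) (ι m) from incl_autFun φ m, gammaForm_autSd]

end Duality

/-! ### The action of the affine group. -/

section Action

variable {V : Type*} [NormedAddCommGroup V] [NormedSpace ℂ V] [FiniteDimensional ℂ V]
  {D : FundamentalData V} {S : LagrangeanSplitting D}
  {E : Type*} [NormedAddCommGroup E] [NormedSpace ℂ E] [FiniteDimensional ℂ E]
  {M : Type*} [TopologicalSpace M] [ChartedSpace E M] [IsManifold 𝓘(ℂ, E) ω M]
  {ι : M → V}

omit [FiniteDimensional ℂ E] [IsManifold 𝓘(ℂ, E) ω M] in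
theorem pointTransformation_autDiffeo_mul (hM : IsLagrangeanPseudoKahler (E := E) D S ι)
    (φ χ : autSd S ι) (x : Cotangent E M) :
    pointTransformation (autDiffeo hM (φ * χ)) x =
      pointTransformation (autDiffeo hM φ) (pointTransformation (autDiffeo hM χ) x) := by
  rw [autDiffeo_mul, pointTransformation_trans]

omit [FiniteDimensional ℂ E] [IsManifold 𝓘(ℂ, E) ω M] in
theorem pointTransformation_autDiffeo_one (hM : IsLagrangeanPseudoKahler (E := E) D S ι)
    (x : Cotangent E M) : pointTransformation (autDiffeo hM (1 : autSd S ι)) x = x := by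
  rw [autDiffeo_one, pointTransformation_refl]

/-- The action of `φ ∈ Aut_sd(M)` on `T^*M` by point transformations. -/
def autPerm (hM : IsLagrangeanPseudoKahler (E := E) D S ι) (φ : autSd S ι) :
    Equiv.Perm (Cotangent E M) where
  toFun := pointTransformation (autDiffeo hM φ)
  invFun := pointTransformation (autDiffeo hM φ⁻¹)
  left_inv x := by
    rw [← pointTransformation_autDiffeo_mul, inv_mul_cancel, pointTransformation_autDiffeo_one]
  right_inv x := by
    rw [← pointTransformation_autDiffeo_mul, mul_inv_cancel, pointTransformation_autDiffeo_one]

theorem isHyperKahlerAutomorphism_autPerm (hM : IsLagrangeanPseudoKahler (E := E) D S ι)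
    (φ : autSd S ι) : IsHyperKahlerAutomorphism S ι (autPerm hM φ) :=
  isHyperKahlerAutomorphism_of_isPluriharmonic hM (contMDiff_pointTransformation _)
    (contMDiff_pointTransformation _)
    (isPluriharmonic_of_eventually fun _ => ⟨fun _ => 0, contDiffAt_const, Filter.Eventually.of_forall fun y =>
      sub_eq_zero.2 (potential_pointTransformation hM φ y)⟩)
    (Omega_pointTransformation _)

/-- The action of `Aut_sd(M)` on `T^*M`. -/
def autHom (hM : IsLagrangeanPseudoKahler (E := E) D S ι) :
    autSd S ι →* Equiv.Perm (Cotangent E M) where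
  toFun := autPerm hM
  map_one' := Equiv.ext (pointTransformation_autDiffeo_one hM)
  map_mul' φ χ := Equiv.ext (pointTransformation_autDiffeo_mul hM φ χ)

/-- The action of the vector group `V^τ` on `T^*M`. -/
def translateHom (E : Type*) [NormedAddCommGroup E] [NormedSpace ℂ E] [ChartedSpace E M]
    [IsManifold 𝓘(ℂ, E) ω M] (D : FundamentalData V) (ι : M → V) :
    Multiplicative (realPoints D) →* Equiv.Perm (Cotangent E M) where
  toFun v := translate E D ι v.toAdd
  map_one' := translate_zero
  map_mul' v w := translate_add v.toAdd w.toAdd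

/-- The action of `V^τ ⋊ Aut_sd(M)` on `T^*M`. -/
def affineAction (hM : IsLagrangeanPseudoKahler (E := E) D S ι) :
    AffineGroup S ι →* Equiv.Perm (Cotangent E M) :=
  SemidirectProduct.lift (translateHom E D ι) (autHom hM) fun φ => by
    refine MonoidHom.ext fun v => ?_
    change translate E D ι (autVector φ v.toAdd) =
      autPerm hM φ * translate E D ι v.toAdd * (autPerm hM φ)⁻¹
    -- The compatibility required of the two factors is that conjugating a translation by `φ` gives
    -- the translation by `φ v`.
    rw [eq_mul_inv_iff_mul_eq]
    exact Equiv.ext fun x => (pointTransformation_autDiffeo_translate hM φ v.toAdd x).symm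

omit [FiniteDimensional ℂ E] in
theorem affineAction_ofVector (hM : IsLagrangeanPseudoKahler (E := E) D S ι)
    (v : realPoints D) : affineAction hM (.ofVector S ι v) = translate E D ι v :=
  SemidirectProduct.lift_inl _ _ _ _

omit [FiniteDimensional ℂ E] in
theorem affineAction_ofAut (hM : IsLagrangeanPseudoKahler (E := E) D S ι)
    (φ : autSd S ι) : affineAction hM (.ofAut S ι φ) = autPerm hM φ :=
  SemidirectProduct.lift_inr _ _ _ _

theorem isHyperKahlerAutomorphism_affineAction (hM : IsLagrangeanPseudoKahler (E := E) D S ι)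
    (a : AffineGroup S ι) : IsHyperKahlerAutomorphism S ι (affineAction hM a) :=
  (isHyperKahlerAutomorphism_translate hM a.left.toAdd).mul
    (isHyperKahlerAutomorphism_autPerm hM a.right)

/-- Fibrewise this is bijectivity of `v ↦ √-1 ψ_m(v)`, applied to the difference `σ' - σ`. -/
theorem existsUnique_translate (hM : IsLagrangeanPseudoKahler (E := E) D S ι) (m : M)
    (σ σ' : TangentSpace 𝓘(ℂ, E) m →L[ℂ] Bundle.Trivial M ℂ m) :
    ∃! v : realPoints D, translate E D ι v ⟨m, σ⟩ = ⟨m, σ'⟩ := by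
  have h : ∀ v : realPoints D, translate E D ι v ⟨m, σ⟩ = ⟨m, σ'⟩ ↔
      Complex.I • psi ι D m v = σ' - σ := fun v => by
    rw [translate_apply, TotalSpace.mk_inj, eq_sub_iff_add_eq']
  simp only [h]
  obtain ⟨v, hv⟩ := exists_eq_psi hM m (σ' - σ)
  exact ⟨v, hv.symm, fun w hw => psi_injective hM m (hw.trans hv)⟩

end Action

end Cmap

end

theorem mainTheorem4
    {V : Type*} [NormedAddCommGroup V] [NormedSpace ℂ V] [FiniteDimensional ℂ V]
    (D : Cmap.FundamentalData V) (S : Cmap.LagrangeanSplitting D)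
    {E : Type*} [NormedAddCommGroup E] [NormedSpace ℂ E] [FiniteDimensional ℂ E]
    {M : Type*} [TopologicalSpace M] [ChartedSpace E M] [IsManifold 𝓘(ℂ, E) ω M]
    (ι : M → V) (hM : Cmap.IsLagrangeanPseudoKahler (E := E) D S ι) :
    ∃ act : Cmap.AffineGroup S ι →* Equiv.Perm (Cmap.Cotangent E M),
      -- the group acts by holomorphic isometries preserving the complex symplectic structure
      (∀ a, Cmap.IsHyperKahlerAutomorphism S ι (act a)) ∧
      -- `Aut_sd(M)` acts by the point transformations of its action on `M`
      (∀ φ : Cmap.autSd S ι, ∃ f : Diffeomorph 𝓘(ℂ, E) 𝓘(ℂ, E) M M ω,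
        (∀ m, ι (f m) = (φ : V ≃ₗ[ℂ] V) (ι m)) ∧
        ∀ x, act (.ofAut S ι φ) x = Cmap.pointTransformation f x) ∧
      -- `v ∈ V^τ` acts by `σ ↦ σ + √-1 ψ_m(v)`; in particular fibres are preserved
      (∀ (v : Cmap.realPoints D) (x : Cmap.Cotangent E M),
        act (.ofVector S ι v) x = ⟨x.1, x.2 + Complex.I • Cmap.psi ι D x.1 v⟩) ∧
      -- `V^τ` acts simply transitively on each fibre
      (∀ (m : M) (σ σ' : TangentSpace 𝓘(ℂ, E) m →L[ℂ] Bundle.Trivial M ℂ m),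
        ∃! v : Cmap.realPoints D, act (.ofVector S ι v) ⟨m, σ⟩ = ⟨m, σ'⟩) ∧
      -- `V^τ` changes the potential only by a pluriharmonic function
      (∀ v : Cmap.realPoints D, Cmap.IsPluriharmonic (Cmap.cotangentModel E)
        (fun x => Cmap.potential S ι (act (.ofVector S ι v) x) - Cmap.potential S ι x)) := by
  refine ⟨Cmap.affineAction hM, Cmap.isHyperKahlerAutomorphism_affineAction hM,
    fun φ => ⟨Cmap.autDiffeo hM φ, Cmap.incl_autFun φ, fun x => ?_⟩, fun v x => ?_,
    fun m σ σ' => ?_, fun v => ?_⟩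
  · rw [Cmap.affineAction_ofAut]
    rfl
  · rw [Cmap.affineAction_ofVector]
    rfl
  · simp only [Cmap.affineAction_ofVector]
    exact Cmap.existsUnique_translate hM m σ σ'
  · simp only [Cmap.affineAction_ofVector]
    exact Cmap.isPluriharmonic_translate hM v
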